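/- Let $n\ge 0$, let $B(n)$ be the set of all subsets of $[n]=\{1,\dots,n\}$ and $B(n)_i$ the set of those of cardinality $i$. For a finite set $S$ let $V(S)$ be the complex vector space with basis $S$; the symmetric group $S_n$ acts on $V(B(n))$ and on $V(B(n)_i)$ by permuting the basis. The up operator $U_n$ on $V(B(n))$ sends $X$ to the sum of all $Y\supseteq X$ with $|Y|=|X|+1$. A *symmetric Jordan chain* starting at rank $k$ ($2k\le n$) is a sequence $(x_k,\dots,x_{n-k})$ of nonzero vectors $x_l\in V(B(n)_l)$ with $U_n(x_l)=x_{l+1}$ for $k\le l<n-k$ and $U_n(x_{n-k})=0$; a *symmetric Jordan basis* is a basis of $V(B(n))$ that is a disjoint union of symmetric Jordan chains. Define a collection $J(n)$ of sequences inductively. $J(0)$ consists of the single chain $(\emptyset)$ (so $J(1)$ consists of the single chain $(\emptyset,\{1\})$). View $V(B(n))$ as a subspace of $V(B(n+1))$, and let $v\mapsto\bar v$ be the linear map with $\bar X=X\cup\{n+1\}$ for $X\subseteq[n]$. Each chain $(x_k,\dots,x_{n-k})$ of $J(n)$ gives, with $x_{k-1}=x_{n+1-k}=0$, the chain $$y_l=x_l+(l-k)\,\bar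 x_{l-1},\qquad k\le l\le n+1-k,$$ of $J(n+1)$ and, if $2k<n$, also the chain $$z_l=(n-k-l+1)\,\bar x_{l-1}-x_l,\qquad k+1\le l\le n-k .$$ (For $2k=n$ the chain $y$ is $(x_k,\bar x_k)$.) For $0\le k\le i\le n-k$ let $W(n,k,i)$ be the span of the elements of rank $i$ (that is, lying in $V(B(n)_i)$) of the chains of $J(n)$ that start at rank $k$. Let $V^{(n-k,k)}$ be the complex irreducible $S_n$-module (Specht module) indexed by the partition $(n-k,k)$, where $(n)$ indexes the trivial module. **Theorem.** 1. $J(n)$ is a symmetric Jordan basis of $V(B(n))$. 2. For all $0\le k\le i\le n-k$, $W(n,k,i)$ is an irreducible $S_n$-submodule of $V(B(n)_i)$, and $W(n,k,i)\cong V^{(n-k,k)}$ as $S_n$-modules. 3. For all $0\le i\le n$, $V(B(n)_i)=\bigoplus_{k\le i\le n-k}W(n,k,i)$. Consequently $$V(B(n)_i)\;\cong\;\bigoplus_{k\le i\le n-k}V^{(n-k,k)}$$ as $S_n$-modules, and $V(B(n)_i)$ is multiplicity free, that is, every irreducible complex representation of $S_n$ occurs in it at most once. -/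

import Mathlib

open scoped DirectSum

noncomputable section

namespace BooleanSJB

/-! ### The space `V(B(n))` and its `S_n`-action -/

/-- `V(B(n))`: the complex vector space with basis the set of all subsets of an `n`-element set. -/
abbrev V (n : ℕ) : Type := Finset (Fin n) →₀ ℂ

/-- The permutation representation of `S_n` on `V(B(n))`: `σ · X = σ(X)` on basis elements. -/
def boolRep (n : ℕ) : Representation ℂ (Equiv.Perm (Fin n)) (V n) where
  toFun σ := Finsupp.lmapDomain ℂ ℂ (Finset.map σ.toEmbedding)
  map_one' := by
    ext X
    simp [Finset.map_eq_image]
  map_mul' σ τ := by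
    ext X
    simp [Finset.map_eq_image, Finset.image_image, Function.comp_def]

/-- `V(B(n)_i)`, as a subspace of `V(B(n))`: the span of the subsets of cardinality `i`. -/
def level (n i : ℕ) : Submodule ℂ (V n) :=
  Submodule.span ℂ {v | ∃ X : Finset (Fin n), X.card = i ∧ v = Finsupp.single X 1}

/-- `V(B(n)_i)` as a subrepresentation of `V(B(n))`. -/
def levelSub (n i : ℕ) : Subrepresentation (boolRep n) where
  toSubmodule := level n i
  apply_mem_toSubmodule σ v hv := by
    have h : level n i ≤ (level n i).comap (boolRep n σ) := by
      refine Submodule.span_le.mpr ?_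
      rintro _ ⟨X, hX, rfl⟩
      refine Submodule.subset_span ⟨X.map σ.toEmbedding, by simpa using hX, ?_⟩
      simp [boolRep]
    exact h hv

/-- The up operator `U_n`: `X ↦` the sum of all `Y` covering `X`. -/
def up (n : ℕ) : V n →ₗ[ℂ] V n :=
  Finsupp.linearCombination ℂ fun X : Finset (Fin n) =>
    ∑ Y : Finset (Fin n) with X ⊆ Y ∧ Y.card = X.card + 1, (Finsupp.single Y 1 : V n)

/-! ### Symmetric Jordan chains and bases -/

/-- A symmetric Jordan chain `(x_k, …, x_{n-k})` starting at rank `k` and ending at rank `n - k`,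
stored as a function `l ↦ x_l` that is zero for `l` outside `[k, n-k]`. -/
structure IsSymmJordanChain (n k : ℕ) (x : ℕ → V n) : Prop where
  two_mul_le : 2 * k ≤ n
  mem_level : ∀ l, k ≤ l → l + k ≤ n → x l ∈ level n l
  ne_zero : ∀ l, k ≤ l → l + k ≤ n → x l ≠ 0
  up_eq : ∀ l, k ≤ l → l + k < n → up n (x l) = x (l + 1)
  up_last : up n (x (n - k)) = 0
  eq_zero : ∀ l, ¬(k ≤ l ∧ l + k ≤ n) → x l = 0

/-- `𝒥 k` is a set of chains for each starting rank `k`. The whole collection is a symmetric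
Jordan basis: its members are symmetric Jordan chains, and the family of all members of all
chains (hence with no repetition between different chains) is a basis of `V(B(n))`. -/
structure IsSymmJordanBasis (n : ℕ) (𝒥 : ℕ → Set (ℕ → V n)) : Prop where
  chain : ∀ k, ∀ x ∈ 𝒥 k, IsSymmJordanChain n k x
  linearIndependent : LinearIndependent ℂ
    fun p : {p : ℕ × (ℕ → V n) × ℕ // p.2.1 ∈ 𝒥 p.1 ∧ p.1 ≤ p.2.2 ∧ p.2.2 + p.1 ≤ n} =>
      p.1.2.1 p.1.2.2
  span_eq_top : Submodule.span ℂ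
    {v | ∃ k, ∃ x ∈ 𝒥 k, ∃ l, k ≤ l ∧ l + k ≤ n ∧ v = x l} = ⊤

/-! ### The inductively built symmetric Jordan basis -/

/-- The inclusion `V(B(n)) → V(B(n+1))` onto the span of the subsets not containing the new
(last) element. -/
def incl (n : ℕ) : V n →ₗ[ℂ] V (n + 1) :=
  Finsupp.lmapDomain ℂ ℂ fun X : Finset (Fin n) => X.map Fin.castSuccEmb

/-- The map `v ↦ v̄`, that is, `X ↦ X ∪ {n+1}`, from `V(B(n))` to `V(B(n+1))`. -/
def bar (n : ℕ) : V n →ₗ[ℂ] V (n + 1) :=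
  Finsupp.lmapDomain ℂ ℂ fun X : Finset (Fin n) => insert (Fin.last n) (X.map Fin.castSuccEmb)

/-- The chain `y_l = x_l + (l-k) x̄_{l-1}`, `k ≤ l ≤ n+1-k`, obtained from a chain
`(x_k, …, x_{n-k})`; for `n = 2k` it is `(x_k, x̄_k)`. -/
def longChain (n k : ℕ) (x : ℕ → V n) : ℕ → V (n + 1) := fun l =>
  if k ≤ l ∧ l + k ≤ n + 1 then
    incl n (x l) + ((l : ℂ) - (k : ℂ)) • bar n (x (l - 1))
  else 0

/-- The chain `z_l = (n-k-l+1) x̄_{l-1} - x_l`, `k+1 ≤ l ≤ n-k`, obtained from a chain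
`(x_k, …, x_{n-k})`; it is used only for `2k < n`. -/
def shortChain (n k : ℕ) (x : ℕ → V n) : ℕ → V (n + 1) := fun l =>
  if k + 1 ≤ l ∧ l + k ≤ n then
    ((n : ℂ) - (k : ℂ) - (l : ℂ) + 1) • bar n (x (l - 1)) - incl n (x l)
  else 0

/-- `sjb n k` is the set of chains starting at rank `k` in the inductively built symmetric Jordan
basis `J(n)`. It starts with the single chain `(∅)` for `n = 0`, so that for `n = 1` there is the
single chain `(∅, {1})`. -/
def sjb : (n : ℕ) → ℕ → Set (ℕ → V n)
  | 0, k => {x | k = 0 ∧ x = fun l => if l = 0 then Finsupp.single ∅ 1 else 0}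
  | n + 1, k =>
      {y | ∃ x ∈ sjb n k, y = longChain n k x} ∪
      {z | ∃ j, k = j + 1 ∧ 2 * j < n ∧ ∃ x ∈ sjb n j, z = shortChain n j x}

/-- `J(n,k)`: the union of all chains of `J(n)` starting at rank `k`. -/
def J (n k : ℕ) : Set (V n) :=
  {v | ∃ x ∈ sjb n k, ∃ l, k ≤ l ∧ l + k ≤ n ∧ v = x l}

/-- `W(n,k,i)`: the span of the elements of rank `i` in `J(n,k)`. -/
def W (n k i : ℕ) : Submodule ℂ (V n) :=
  Submodule.span ℂ {v | v ∈ J n k ∧ v ∈ level n i}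

/-! ### The irreducible modules `V^μ` of the symmetric group (Specht modules) -/

/-- The permutation representation of `S_n` on the space with basis all functions
`f : [n] → ℕ`, with `σ · f = f ∘ σ⁻¹`. A tabloid is encoded as the function that sends each
number to the index of the row that contains it. -/
def rowRep (n : ℕ) : Representation ℂ (Equiv.Perm (Fin n)) ((Fin n → ℕ) →₀ ℂ) where
  toFun σ := Finsupp.lmapDomain ℂ ℂ fun f => f ∘ ⇑σ⁻¹
  map_one' := by
    refine Finsupp.lhom_ext fun f a => ?_
    simp
  map_mul' σ τ := by
    refine Finsupp.lhom_ext fun f a => ?_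
    simp [Function.comp_assoc]

/-- A Young tableau of shape `μ`: a bijection between the numbers and the boxes; `t x` is the
box (row index, column index) that contains `x`. -/
abbrev Tableau (n : ℕ) (μ : YoungDiagram) : Type := Fin n ≃ {c : ℕ × ℕ // c ∈ μ.cells}

/-- The tabloid of a tableau. -/
def tabloid {n : ℕ} {μ : YoungDiagram} (t : Tableau n μ) : Fin n → ℕ := fun x => (t x).1.1

open Classical in
/-- The polytabloid `e_t = ∑ sgn(σ) σ{t}`, over the permutations `σ` that preserve the columns
of `t`. -/
def polytabloid {n : ℕ} {μ : YoungDiagram} (t : Tableau n μ) : (Fin n → ℕ) →₀ ℂ :=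
  ∑ σ : Equiv.Perm (Fin n) with ∀ x, (t (σ x)).1.2 = (t x).1.2,
    ((Equiv.Perm.sign σ : ℤ) : ℂ) • rowRep n σ (Finsupp.single (tabloid t) 1)

theorem rowRep_polytabloid {n : ℕ} {μ : YoungDiagram} (t : Tableau n μ)
    (π : Equiv.Perm (Fin n)) :
    rowRep n π (polytabloid t) = polytabloid (π⁻¹.trans t : Tableau n μ) := by
  classical
  have h1 : Finsupp.single (tabloid (π⁻¹.trans t : Tableau n μ)) (1 : ℂ) =
      rowRep n π (Finsupp.single (tabloid t) 1) := by
    simp only [rowRep, MonoidHom.coe_mk, OneHom.coe_mk, Finsupp.lmapDomain_apply,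
      Finsupp.mapDomain_single]
    rfl
  unfold polytabloid
  rw [map_sum, h1]
  refine Finset.sum_equiv (MulAut.conj π).toEquiv ?_ ?_
  · intro σ
    simp only [Finset.mem_filter, Finset.mem_univ, true_and]
    constructor
    · intro h x
      simpa using h (π⁻¹ x)
    · intro h x
      simpa using h (π x)
  · intro σ _
    have h2 : (MulAut.conj π).toEquiv σ = π * σ * π⁻¹ := rfl
    have h3 : Equiv.Perm.sign (π * σ * π⁻¹) = Equiv.Perm.sign σ := by
      rw [Equiv.Perm.sign_mul, Equiv.Perm.sign_mul, Equiv.Perm.sign_inv, mul_comm, ← mul_assoc,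
        Int.units_mul_self, one_mul]
    rw [h2, h3, map_smul, ← Module.End.mul_apply, ← Module.End.mul_apply, ← map_mul, ← map_mul]
    simp

/-- The Specht module `V^μ` of a Young diagram `μ` with `n` boxes: the span of the polytabloids
of all tableaux of shape `μ`. -/
def specht (n : ℕ) (μ : YoungDiagram) : Subrepresentation (rowRep n) where
  toSubmodule := Submodule.span ℂ (Set.range fun t : Tableau n μ => polytabloid t)
  apply_mem_toSubmodule π v hv := by
    have h : Submodule.span ℂ (Set.range fun t : Tableau n μ => polytabloid t) ≤
        (Submodule.span ℂ (Set.range fun t : Tableau n μ => polytabloid t)).comap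
          (rowRep n π) := by
      refine Submodule.span_le.mpr ?_
      rintro _ ⟨t, rfl⟩
      refine Submodule.subset_span ⟨π⁻¹.trans t, ?_⟩
      exact (rowRep_polytabloid t π).symm
    exact h hv

/-- The Young diagram of the partition `(n-k, k)`. -/
def twoRow (n k : ℕ) (h : 2 * k ≤ n) : YoungDiagram :=
  YoungDiagram.ofRowLens [n - k, k] (by
    refine List.Pairwise.sortedGE ?_
    simp
    omega)

/-- The Specht module `V^{(n-k,k)}`. -/
def spechtTwoRow (n k : ℕ) (h : 2 * k ≤ n) : Subrepresentation (rowRep n) :=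
  specht n (twoRow n k h)

/-! ### Multiplicity freeness -/

/-- A (finite-dimensional) complex representation is multiplicity free if every irreducible
representation `σ` occurs in it at most once, that is, `dim Hom_G(σ, ρ) ≤ 1`. -/
def IsMultiplicityFree {G E : Type} [Group G] [AddCommMonoid E] [Module ℂ E]
    (ρ : Representation ℂ G E) : Prop :=
  ∀ (M : Type) [AddCommGroup M] [Module ℂ M] (σ : Representation ℂ G M),
    σ.IsIrreducible → Module.rank ℂ (σ.IntertwiningMap ρ) ≤ 1

end BooleanSJB

end

noncomputable section

namespace BooleanSJB

/-! Basis. Up to inclusion, the up operator `U` of `[n+1]` satisfies `U x = U x + x̄` and `U x̄ = (U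
x)‾`, so the two new sequences obey the chain rule. Since `y_{l+1} + z_{l+1} = (n-2k+1) x̄_l`, they
span whenever the old chains do. Each position in `J(n)` yields at most two in `J(n+1)`, so a
spanning family of at most `2^n` vectors results: a basis, with nonvanishing as a by-product
(`span_range_elt`, `finite_index_and_card_le`).

Invariance. `W(n,k,k)` is the kernel of `U^(n-2k+1)` on rank `k`, and `W(n,k,i)` is its image under
`U^(i-k)`. As `U` commutes with `S_n`, both are submodules (`mem_W_self_iff`, `W_eq_map`).

Irreducibility. An equivariant operator on `V(B(n)_i)` is a matrix whose `(X, Y)` entry depends only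
on `|X ∩ Y|`. The number of possible intersection sizes equals the number of summands `W(n,k,i)`, so
the independent projections onto these summands span the commutant (`commutant_eq_span_projW`).
Every equivariant operator is thus scalar on each `W(n,k,i)`. With Maschke's theorem this gives
irreducibility, and commutativity of the commutant gives multiplicity freeness.

Specht modules. Sending a tabloid to its second row maps polytabloids into rank `k`. `U^(n-2k+1)`
carries them to column-antisymmetrized sets of size `n-k+1`, which vanish because there are only
`n-k` columns. The image is therefore a nonzero submodule of the irreducible `W(n,k,k)`, hence all
of it. -/

theorem two_mul_le {n k i : ℕ} (hki : k ≤ i) (hin : i + k ≤ n) : 2 * k ≤ n :=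
  (Nat.two_mul k).trans_le ((Nat.add_le_add_right hki k).trans hin)

/-! ### The levels and the up operator -/

theorem mem_level {n i : ℕ} {v : V n} :
    v ∈ level n i ↔ ∀ X : Finset (Fin n), v X ≠ 0 → X.card = i := by
  have h : level n i = Finsupp.supported ℂ ℂ {X : Finset (Fin n) | X.card = i} := by
    rw [Finsupp.supported_eq_span_single, level]
    congr 1
    ext v
    simp [eq_comm]
  rw [h, Finsupp.mem_supported']
  exact forall_congr' fun X => by simp only [Set.mem_ofPred_eq]; tauto

theorem single_mem_level {n : ℕ} (X : Finset (Fin n)) (c : ℂ) :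
    Finsupp.single X c ∈ level n X.card := by
  rw [mem_level]
  intro Y hY
  rw [Finsupp.single_apply] at hY
  split_ifs at hY with h
  · rw [h]
  · exact absurd rfl hY

/-- Summing over all elements, with zero for those already in `X`, lets the sum be reindexed by a
permutation and split at the last element of `Fin (n + 1)`. -/
theorem up_single (n : ℕ) (X : Finset (Fin n)) :
    up n (Finsupp.single X 1) = ∑ a, if a ∈ X then 0 else Finsupp.single (insert a X) 1 := by
  have h : (Finset.univ.filter fun Y : Finset (Fin n) => X ⊆ Y ∧ Y.card = X.card + 1) =
      (Finset.univ.filter fun a => a ∉ X).image fun a => insert a X := by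
    ext Y
    simp only [Finset.mem_filter, Finset.mem_univ, true_and, Finset.mem_image]
    rw [eq_comm (a := Y.card), ← Finset.exists_eq_insert_iff]
  rw [up, Finsupp.linearCombination_single, one_smul, h, Finset.sum_image, Finset.sum_filter]
  · exact Finset.sum_congr rfl fun a _ => by split_ifs <;> simp_all
  · intro a ha b hb hab
    simp only [Finset.coe_filter, Finset.mem_univ, true_and, Set.mem_ofPred_eq] at ha hb
    have h1 : a ∈ insert b X := by
      rw [← show insert a X = insert b X from hab]
      exact Finset.mem_insert_self a X
    exact (Finset.mem_insert.mp h1).resolve_right ha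

theorem up_mem_level {n i : ℕ} {v : V n} (hv : v ∈ level n i) : up n v ∈ level n (i + 1) := by
  have h : level n i ≤ (level n (i + 1)).comap (up n) := by
    refine Submodule.span_le.mpr ?_
    rintro _ ⟨X, rfl, rfl⟩
    change up n _ ∈ level n _
    rw [up_single]
    refine Submodule.sum_mem _ fun a _ => ?_
    split_ifs with ha
    · exact Submodule.zero_mem _
    · rw [← Finset.card_insert_of_notMem ha]
      exact single_mem_level _ _
  exact h hv

theorem pow_up_mem_level {n i : ℕ} {v : V n} (hv : v ∈ level n i) (m : ℕ) :
    (up n ^ m) v ∈ level n (i + m) := by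
  induction m with
  | zero => simpa using hv
  | succ m ih =>
    rw [pow_succ', Module.End.mul_apply, ← add_assoc]
    exact up_mem_level ih

theorem boolRep_single {n : ℕ} (g : Equiv.Perm (Fin n)) (X : Finset (Fin n)) (c : ℂ) :
    boolRep n g (Finsupp.single X c) = Finsupp.single (X.map g.toEmbedding) c := by
  simp [boolRep]

theorem boolRep_mem_level {n i : ℕ} (g : Equiv.Perm (Fin n)) {v : V n} (hv : v ∈ level n i) :
    boolRep n g v ∈ level n i :=
  (levelSub n i).apply_mem_toSubmodule g hv

theorem up_boolRep {n : ℕ} (g : Equiv.Perm (Fin n)) (v : V n) :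
    up n (boolRep n g v) = boolRep n g (up n v) := by
  induction v using Finsupp.induction_linear with
  | zero => simp
  | add v w hv hw => simp only [map_add, hv, hw]
  | single X c =>
    rw [← mul_one c, ← smul_eq_mul, ← Finsupp.smul_single, map_smul, map_smul, map_smul, map_smul,
      boolRep_single, up_single, up_single, map_sum, ← Equiv.sum_comp g]
    congr 1
    refine Finset.sum_congr rfl fun a _ => ?_
    have h : g a ∈ X.map g.toEmbedding ↔ a ∈ X := by simp
    by_cases ha : a ∈ X
    · simp [ha]
    · rw [if_neg (by rwa [h]), if_neg ha, boolRep_single, Finset.map_insert]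
      rfl

theorem pow_up_boolRep {n : ℕ} (g : Equiv.Perm (Fin n)) (m : ℕ) (v : V n) :
    (up n ^ m) (boolRep n g v) = boolRep n g ((up n ^ m) v) := by
  induction m with
  | zero => rfl
  | succ m ih => rw [pow_succ', Module.End.mul_apply, ih, up_boolRep, Module.End.mul_apply]

/-! ### Passing from `n` to `n + 1` -/

theorem incl_single {n : ℕ} (X : Finset (Fin n)) (c : ℂ) :
    incl n (Finsupp.single X c) = Finsupp.single (X.map Fin.castSuccEmb) c := by
  simp [incl]

theorem bar_single {n : ℕ} (X : Finset (Fin n)) (c : ℂ) :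
    bar n (Finsupp.single X c) =
      Finsupp.single (insert (Fin.last n) (X.map Fin.castSuccEmb)) c := by
  simp [bar]

theorem last_notMem_map_castSucc {n : ℕ} (X : Finset (Fin n)) :
    Fin.last n ∉ X.map Fin.castSuccEmb := by
  simp [Fin.castSucc_ne_last]

theorem incl_mem_level {n i : ℕ} {v : V n} (hv : v ∈ level n i) : incl n v ∈ level (n + 1) i := by
  have h : level n i ≤ (level (n + 1) i).comap (incl n) := by
    refine Submodule.span_le.mpr ?_
    rintro _ ⟨X, rfl, rfl⟩
    change incl n _ ∈ level (n + 1) _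
    rw [incl_single, ← Finset.card_map Fin.castSuccEmb]
    exact single_mem_level _ _
  exact h hv

theorem bar_mem_level {n i : ℕ} {v : V n} (hv : v ∈ level n i) :
    bar n v ∈ level (n + 1) (i + 1) := by
  have h : level n i ≤ (level (n + 1) (i + 1)).comap (bar n) := by
    refine Submodule.span_le.mpr ?_
    rintro _ ⟨X, rfl, rfl⟩
    change bar n _ ∈ level (n + 1) _
    rw [bar_single, ← Finset.card_map Fin.castSuccEmb,
      ← Finset.card_insert_of_notMem (last_notMem_map_castSucc X)]
    exact single_mem_level _ _
  exact h hv

theorem up_incl {n : ℕ} (v : V n) : up (n + 1) (incl n v) = incl n (up n v) + bar n v := by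
  induction v using Finsupp.induction_linear with
  | zero => simp
  | add v w hv hw => simp only [map_add, hv, hw]; abel
  | single X c =>
    rw [← mul_one c, ← smul_eq_mul, ← Finsupp.smul_single]
    simp only [map_smul, ← smul_add]
    rw [incl_single, bar_single, up_single, up_single, Fin.sum_univ_castSucc,
      if_neg (last_notMem_map_castSucc X), map_sum]
    congr 2
    refine Finset.sum_congr rfl fun a _ => ?_
    by_cases ha : a ∈ X
    · simp [ha]
    · rw [if_neg (by simpa using ha), if_neg ha, incl_single, Finset.map_insert]
      rfl

theorem up_bar {n : ℕ} (v : V n) : up (n + 1) (bar n v) = bar n (up n v) := by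
  induction v using Finsupp.induction_linear with
  | zero => simp
  | add v w hv hw => simp only [map_add, hv, hw]
  | single X c =>
    rw [← mul_one c, ← smul_eq_mul, ← Finsupp.smul_single]
    simp only [map_smul]
    rw [bar_single, up_single, up_single, Fin.sum_univ_castSucc,
      if_pos (Finset.mem_insert_self _ _), map_sum, add_zero]
    congr 1
    refine Finset.sum_congr rfl fun a _ => ?_
    by_cases ha : a ∈ X
    · simp [ha]
    · rw [if_neg (by simpa [Fin.castSucc_ne_last] using ha), if_neg ha, bar_single,
        Finset.map_insert, Finset.insert_comm]
      rfl

theorem range_incl_sup_range_bar (n : ℕ) :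
    LinearMap.range (incl n) ⊔ LinearMap.range (bar n) = ⊤ := by
  refine eq_top_iff.mpr fun v _ => ?_
  induction v using Finsupp.induction_linear with
  | zero => exact Submodule.zero_mem _
  | add v w hv hw => exact Submodule.add_mem _ (hv trivial) (hw trivial)
  | single Y c =>
    set X : Finset (Fin n) := Finset.univ.filter fun a => Fin.castSucc a ∈ Y with hX
    by_cases hY : Fin.last n ∈ Y
    · refine Submodule.mem_sup_right ⟨Finsupp.single X c, ?_⟩
      rw [bar_single]
      congr 1
      ext a
      induction a using Fin.lastCases <;> simp [hX, hY, Fin.castSucc_ne_last]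
    · refine Submodule.mem_sup_left ⟨Finsupp.single X c, ?_⟩
      rw [incl_single]
      congr 1
      ext a
      induction a using Fin.lastCases <;> simp [hX, hY, Fin.castSucc_ne_last]

/-! ### The chains of `J(n)` -/

/-- The properties of a chain that do not involve its entries being nonzero. -/
structure IsUpChain (n k : ℕ) (x : ℕ → V n) : Prop where
  two_mul_le : 2 * k ≤ n
  mem_level : ∀ l, x l ∈ level n l
  up_eq : ∀ l, k ≤ l → up n (x l) = x (l + 1)
  eq_zero : ∀ l, ¬(k ≤ l ∧ l + k ≤ n) → x l = 0

/-- Past the last rank both entries of `x` vanish, so the truncation can be ignored and the up rule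
needs no special case at the end of the chain. -/
theorem IsUpChain.longChain_apply {n k : ℕ} {x : ℕ → V n} (hx : IsUpChain n k x) {l : ℕ}
    (hl : k ≤ l) :
    longChain n k x l = incl n (x l) + ((l : ℂ) - (k : ℂ)) • bar n (x (l - 1)) := by
  have h2 := hx.two_mul_le
  unfold longChain
  split_ifs with h
  · rfl
  · rw [hx.eq_zero l (by omega), hx.eq_zero (l - 1) (by omega)]
    simp

theorem IsUpChain.shortChain_apply {n k : ℕ} {x : ℕ → V n} (hx : IsUpChain n k x) {l : ℕ}
    (hl : k + 1 ≤ l) :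
    shortChain n k x l =
      ((n : ℂ) - (k : ℂ) - (l : ℂ) + 1) • bar n (x (l - 1)) - incl n (x l) := by
  have h2 := hx.two_mul_le
  unfold shortChain
  split_ifs with h
  · rfl
  · rw [hx.eq_zero l (by omega)]
    -- Here `x (l - 1)` is the last entry of the chain and need not vanish, but its coefficient `n -
    -- k - l + 1` does.
    by_cases h3 : l = n - k + 1
    · subst h3
      rw [Nat.cast_add, Nat.cast_sub (by omega)]
      simp
    · rw [hx.eq_zero (l - 1) (by omega)]
      simp

/-- The summand `bar n (x l)` contributed by `up_incl` raises the coefficient `l - k` to `l + 1 -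
k`. -/
theorem IsUpChain.longChain {n k : ℕ} {x : ℕ → V n} (hx : IsUpChain n k x) :
    IsUpChain (n + 1) k (longChain n k x) where
  two_mul_le := by have := hx.two_mul_le; omega
  mem_level l := by
    unfold BooleanSJB.longChain
    split_ifs with h
    · refine Submodule.add_mem _ (incl_mem_level (hx.mem_level l)) ?_
      -- For `l = 0` the truncated `l - 1` is `0` and `bar n (x 0)` has the wrong rank; its
      -- coefficient is zero.
      rcases Nat.eq_zero_or_pos l with rfl | hl
      · obtain rfl : k = 0 := by omega
        simp
      · have h1 := bar_mem_level (hx.mem_level (l - 1))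
        rw [Nat.sub_add_cancel hl] at h1
        exact Submodule.smul_mem _ _ h1
    · exact Submodule.zero_mem _
  up_eq l hl := by
    rw [hx.longChain_apply hl, hx.longChain_apply (by omega), map_add, map_smul, up_incl, up_bar,
      hx.up_eq l hl, Nat.add_sub_cancel]
    -- At `l = k` the up rule is not available for `x (l - 1)`, whose coefficient is zero.
    rcases hl.eq_or_lt with rfl | hl
    · simp
    · rw [hx.up_eq (l - 1) (by omega), Nat.sub_add_cancel (by omega)]
      push_cast
      module
  eq_zero l hl := if_neg (by omega)

/-- The summand `-bar n (x l)` contributed by `up_incl` lowers the coefficient `n - k - l + 1` by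
one. -/
theorem IsUpChain.shortChain {n k : ℕ} {x : ℕ → V n} (hx : IsUpChain n k x) (hk : 2 * k < n) :
    IsUpChain (n + 1) (k + 1) (shortChain n k x) where
  two_mul_le := by omega
  mem_level l := by
    unfold BooleanSJB.shortChain
    split_ifs with h
    · have h1 := bar_mem_level (hx.mem_level (l - 1))
      rw [Nat.sub_add_cancel (by omega)] at h1
      exact Submodule.sub_mem _ (Submodule.smul_mem _ _ h1) (incl_mem_level (hx.mem_level l))
    · exact Submodule.zero_mem _
  up_eq l hl := by
    rw [hx.shortChain_apply hl, hx.shortChain_apply (by omega), map_sub, map_smul, up_incl, up_bar,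
      hx.up_eq l (by omega), Nat.add_sub_cancel, hx.up_eq (l - 1) (by omega),
      Nat.sub_add_cancel (by omega)]
    push_cast
    module
  eq_zero l hl := if_neg (by omega)

theorem isUpChain_of_mem_sjb {n k : ℕ} {x : ℕ → V n} (hx : x ∈ sjb n k) : IsUpChain n k x := by
  induction n generalizing k with
  | zero =>
    obtain ⟨rfl, rfl⟩ := hx
    refine ⟨le_rfl, fun l => ?_, fun l _ => ?_, fun l hl => if_neg (by omega)⟩
    · rcases l with _ | l
      · exact single_mem_level (∅ : Finset (Fin 0)) 1
      · exact Submodule.zero_mem _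
    · rcases l with _ | l
      · simp [up_single]
      · simp
  | succ n ih =>
    rcases hx with ⟨x, hx, rfl⟩ | ⟨j, rfl, hj, x, hx, rfl⟩
    · exact (ih hx).longChain
    · exact (ih hx).shortChain hj

/-! ### `J(n)` is a basis: spanning and counting -/

/-- The positions in the chains of `J(n)`: starting rank, chain, and rank. -/
abbrev Index (n : ℕ) : Type :=
  {p : ℕ × (ℕ → V n) × ℕ // p.2.1 ∈ sjb n p.1 ∧ p.1 ≤ p.2.2 ∧ p.2.2 + p.1 ≤ n}

/-- The element of `J(n)` at a position. -/
def elt (n : ℕ) (p : Index n) : V n := p.1.2.1 p.1.2.2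

/-- The relation `y_{l+1} + z_{l+1} = (n - 2k + 1) x̄_l` recovers `x̄_l`, the scalar being nonzero;
then `x_l = y_l - (l - k) x̄_{l-1}`. -/
theorem incl_mem_and_bar_mem {n : ℕ} {S : Submodule ℂ (V (n + 1))}
    (hS : ∀ q, elt (n + 1) q ∈ S) (p : Index n) :
    incl n (elt n p) ∈ S ∧ bar n (elt n p) ∈ S := by
  have hlong : ∀ {k : ℕ} {x : ℕ → V n}, x ∈ sjb n k → ∀ l, k ≤ l → l + k ≤ n + 1 →
      incl n (x l) + ((l : ℂ) - (k : ℂ)) • bar n (x (l - 1)) ∈ S := by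
    intro k x hx l h1 h2
    rw [← (isUpChain_of_mem_sjb hx).longChain_apply h1]
    exact hS ⟨(k, longChain n k x, l), Or.inl ⟨x, hx, rfl⟩, h1, h2⟩
  have hbar : ∀ {k : ℕ} {x : ℕ → V n}, x ∈ sjb n k → ∀ l, k ≤ l → l + k ≤ n →
      bar n (x l) ∈ S := by
    intro k x hx l h1 h2
    have hc := isUpChain_of_mem_sjb hx
    have h0 : (n : ℂ) - 2 * k + 1 ≠ 0 := by
      have h3 : (n : ℂ) - 2 * k + 1 = ((n - 2 * k + 1 : ℕ) : ℂ) := by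
        rw [Nat.cast_add, Nat.cast_sub (by omega)]
        push_cast
        ring
      rw [h3]
      exact Nat.cast_ne_zero.mpr (Nat.succ_ne_zero _)
    have hy := hlong hx (l + 1) (by omega) (by omega)
    rw [Nat.add_sub_cancel] at hy
    rw [← Submodule.smul_mem_iff S h0]
    -- At `l = n - k` there is no `z_{l+1}`, but `y_{l+1}` alone is already `(n - 2k + 1) x̄_l`.
    rcases h2.eq_or_lt with h2 | h2
    · rw [hc.eq_zero (l + 1) (by omega), map_zero, zero_add] at hy
      have h4 : (n : ℂ) = l + k := by rw [← h2]; push_cast; ring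
      convert! hy using 2
      rw [h4]
      push_cast
      ring
    · have hz : shortChain n k x (l + 1) ∈ S :=
        hS ⟨(k + 1, shortChain n k x, l + 1), Or.inr ⟨k, rfl, by omega, x, hx, rfl⟩,
          by simpa using h1, by change l + 1 + (k + 1) ≤ n + 1; omega⟩
      rw [hc.shortChain_apply (by omega), Nat.add_sub_cancel] at hz
      convert! S.add_mem hy hz using 1
      push_cast
      module
  obtain ⟨⟨k, x, l⟩, hx, h1, h2⟩ := p
  change k ≤ l at h1
  change l + k ≤ n at h2
  change incl n (x l) ∈ S ∧ bar n (x l) ∈ S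
  refine ⟨?_, hbar hx l h1 h2⟩
  have hy := hlong hx l h1 (by omega)
  rcases h1.eq_or_lt with h3 | h3
  · subst h3
    simpa using hy
  · have hb := S.smul_mem ((l : ℂ) - k) (hbar hx (l - 1) (by omega) (by omega))
    have := S.sub_mem hy hb
    rwa [add_sub_cancel_right] at this

theorem span_range_elt (n : ℕ) : Submodule.span ℂ (Set.range (elt n)) = ⊤ := by
  induction n with
  | zero =>
    refine eq_top_iff.mpr fun v _ => ?_
    have h : Finsupp.single ∅ 1 ∈ Set.range (elt 0) :=
      ⟨⟨(0, fun l => if l = 0 then Finsupp.single ∅ 1 else 0, 0), ⟨rfl, rfl⟩, le_rfl, le_rfl⟩, rfl⟩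
    have h1 : v = v ∅ • Finsupp.single ∅ 1 := by
      refine Finsupp.ext fun X => ?_
      rw [Subsingleton.elim X ∅]
      simp
    rw [h1]
    exact Submodule.smul_mem _ _ (Submodule.subset_span h)
  | succ n ih =>
    have key := incl_mem_and_bar_mem (S := Submodule.span ℂ (Set.range (elt (n + 1))))
      fun q => Submodule.subset_span ⟨q, rfl⟩
    rw [eq_top_iff, ← range_incl_sup_range_bar, sup_le_iff, LinearMap.range_eq_map,
      LinearMap.range_eq_map, ← ih, Submodule.map_span_le, Submodule.map_span_le]
    refine ⟨?_, ?_⟩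
    · rintro _ ⟨p, rfl⟩
      exact (key p).1
    · rintro _ ⟨p, rfl⟩
      exact (key p).2

open Classical in
-- A position of rank `l` in a chain `x` accounts for `y_l` and for `z_{l+1}`, or for the last entry
-- `y_{n+1-k}` in place of `z_{l+1}` when `l = n - k`. This covers `J(n+1)`. Only the upper bound is
-- needed, so distinctness of the new chains is never checked.
theorem finite_index_and_card_le (n : ℕ) : Finite (Index n) ∧ Nat.card (Index n) ≤ 2 ^ n := by
  induction n with
  | zero =>
    have : Subsingleton (Index 0) := by
      constructor
      rintro ⟨⟨k, x, l⟩, ⟨h1, h2⟩, h3, h4⟩ ⟨⟨k', x', l'⟩, ⟨h1', h2'⟩, h3', h4'⟩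
      change k = 0 at h1
      change k' = 0 at h1'
      change x = _ at h2
      change x' = _ at h2'
      change l + k ≤ 0 at h4
      change l' + k' ≤ 0 at h4'
      obtain rfl : l = 0 := by omega
      obtain rfl : l' = 0 := by omega
      subst h1 h2 h1' h2'
      rfl
    exact ⟨inferInstance, by simpa using Finite.card_le_one_iff_subsingleton.mpr this⟩
  | succ n ih =>
    obtain ⟨hfin, hcard⟩ := ih
    let F : Index n × Bool → Index (n + 1) := fun q =>
      if q.2 = true then
        ⟨(q.1.1.1, longChain n q.1.1.1 q.1.1.2.1, q.1.1.2.2), Or.inl ⟨_, q.1.2.1, rfl⟩,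
          q.1.2.2.1, q.1.2.2.2.trans n.le_succ⟩
      else if h : q.1.1.2.2 + q.1.1.1 < n then
        ⟨(q.1.1.1 + 1, shortChain n q.1.1.1 q.1.1.2.1, q.1.1.2.2 + 1),
          Or.inr ⟨q.1.1.1, rfl, by have := q.1.2.2.1; omega, _, q.1.2.1, rfl⟩,
          Nat.succ_le_succ q.1.2.2.1, by dsimp only; omega⟩
      else
        ⟨(q.1.1.1, longChain n q.1.1.1 q.1.1.2.1, q.1.1.2.2 + 1), Or.inl ⟨_, q.1.2.1, rfl⟩,
          q.1.2.2.1.trans (Nat.le_succ _), by have := q.1.2.2.2; dsimp only; omega⟩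
    have hF : Function.Surjective F := by
      rintro ⟨⟨k, y, l⟩, hy, h1, h2⟩
      change k ≤ l at h1
      change l + k ≤ n + 1 at h2
      change y ∈ sjb (n + 1) k at hy
      obtain ⟨x, hx, rfl⟩ | ⟨j, rfl, hj, x, hx, rfl⟩ := id hy
      · by_cases hl : l + k ≤ n
        · exact ⟨(⟨(k, x, l), hx, h1, hl⟩, true), rfl⟩
        · have := (isUpChain_of_mem_sjb hx).two_mul_le
          obtain ⟨m, rfl⟩ : ∃ m, l = m + 1 := ⟨l - 1, by omega⟩
          refine ⟨(⟨(k, x, m), hx, by dsimp only; omega, by dsimp only; omega⟩, false), ?_⟩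
          simp only [F, Bool.false_eq_true, if_false]
          rw [dif_neg (by omega)]
      · obtain ⟨m, rfl⟩ : ∃ m, l = m + 1 := ⟨l - 1, by omega⟩
        refine ⟨(⟨(j, x, m), hx, by dsimp only; omega, by dsimp only; omega⟩, false), ?_⟩
        simp only [F, Bool.false_eq_true, if_false]
        rw [dif_pos (by omega)]
    refine ⟨Finite.of_surjective F hF, (Nat.card_le_card_of_surjective F hF).trans ?_⟩
    rw [Nat.card_prod, Nat.card_eq_fintype_card (α := Bool), Fintype.card_bool, pow_succ]
    exact Nat.mul_le_mul_right _ hcard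

theorem finrank_V (n : ℕ) : Module.finrank ℂ (V n) = 2 ^ n := by
  rw [Module.finrank_finsupp_self, Fintype.card_finset, Fintype.card_fin]

/-- A spanning family with at most `2 ^ n` members is a basis. Indexing by positions makes this say
also that no entry is zero and none is repeated. -/
theorem linearIndependent_elt (n : ℕ) : LinearIndependent ℂ (elt n) := by
  obtain ⟨hfin, hcard⟩ := finite_index_and_card_le n
  have := Fintype.ofFinite (Index n)
  refine linearIndependent_of_top_le_span_of_card_eq_finrank (span_range_elt n).ge ?_
  rw [Nat.card_eq_fintype_card] at hcard
  refine le_antisymm (hcard.trans (finrank_V n).ge) ?_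
  rw [← finrank_top, ← span_range_elt n]
  exact finrank_range_le_card (elt n)

theorem isSymmJordanBasis_sjb (n : ℕ) : IsSymmJordanBasis n (sjb n) where
  chain k x hx := by
    have hc := isUpChain_of_mem_sjb hx
    refine ⟨hc.two_mul_le, fun l _ _ => hc.mem_level l, fun l h1 h2 => ?_,
      fun l h1 _ => hc.up_eq l h1, ?_, hc.eq_zero⟩
    · exact (linearIndependent_elt n).ne_zero ⟨(k, x, l), hx, h1, h2⟩
    · have := hc.two_mul_le
      rw [hc.up_eq _ (by omega), hc.eq_zero _ (by omega)]
  linearIndependent := linearIndependent_elt n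
  span_eq_top := by
    rw [eq_top_iff, ← span_range_elt n]
    refine Submodule.span_mono ?_
    rintro _ ⟨p, rfl⟩
    exact ⟨p.1.1, p.1.2.1, p.2.1, p.1.2.2, p.2.2.1, p.2.2.2, rfl⟩

/-! ### Projection onto a level -/

theorem eq_of_mem_level {n i j : ℕ} {v : V n} (hv : v ≠ 0) (hi : v ∈ level n i)
    (hj : v ∈ level n j) : i = j := by
  obtain ⟨X, hX⟩ := Finsupp.ne_iff.mp hv
  rw [← mem_level.mp hi X hX, ← mem_level.mp hj X hX]

/-- The projection of `V(B(n))` onto `V(B(n)_i)`. -/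
def levelProj (n i : ℕ) : V n →ₗ[ℂ] V n where
  toFun v := v.filter fun X => X.card = i
  map_add' _ _ := Finsupp.filter_add
  map_smul' _ _ := Finsupp.filter_smul

theorem levelProj_apply {n i : ℕ} (v : V n) (X : Finset (Fin n)) :
    levelProj n i v X = if X.card = i then v X else 0 :=
  Finsupp.filter_apply _ _ _

theorem levelProj_mem {n i : ℕ} (v : V n) : levelProj n i v ∈ level n i := by
  rw [mem_level]
  intro X hX
  rw [levelProj_apply] at hX
  by_contra h
  exact hX (if_neg h)

theorem levelProj_of_mem {n i : ℕ} {v : V n} (hv : v ∈ level n i) : levelProj n i v = v := by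
  refine Finsupp.ext fun X => ?_
  rw [levelProj_apply]
  split_ifs with h
  · rfl
  · by_contra h1
    exact h (mem_level.mp hv X (Ne.symm h1))

theorem levelProj_of_mem_of_ne {n i j : ℕ} {v : V n} (hv : v ∈ level n j) (hij : j ≠ i) :
    levelProj n i v = 0 := by
  refine Finsupp.ext fun X => ?_
  rw [levelProj_apply, Finsupp.zero_apply]
  split_ifs with h
  · by_contra h1
    exact hij ((mem_level.mp hv X h1).symm.trans h)
  · rfl

theorem boolRep_apply_map {n : ℕ} (g : Equiv.Perm (Fin n)) (v : V n) (X : Finset (Fin n)) :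
    boolRep n g v (X.map g.toEmbedding) = v X :=
  Finsupp.mapDomain_apply (Finset.map_injective _) v X

theorem levelProj_boolRep {n i : ℕ} (g : Equiv.Perm (Fin n)) (v : V n) :
    levelProj n i (boolRep n g v) = boolRep n g (levelProj n i v) := by
  refine Finsupp.ext fun X => ?_
  obtain ⟨Y, rfl⟩ : ∃ Y : Finset (Fin n), X = Y.map g.toEmbedding :=
    ⟨X.map g.symm.toEmbedding, by simp [Finset.map_map]⟩
  rw [boolRep_apply_map, levelProj_apply, levelProj_apply, boolRep_apply_map, Finset.card_map]

/-! ### The subspaces `W(n,k,i)` in terms of the basis -/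

theorem elt_mem_level {n : ℕ} (p : Index n) : elt n p ∈ level n p.1.2.2 :=
  (isUpChain_of_mem_sjb p.2.1).mem_level _

theorem elt_ne_zero {n : ℕ} (p : Index n) : elt n p ≠ 0 :=
  (linearIndependent_elt n).ne_zero p

/-- A nonzero vector lies in only one level, so the condition on the vector becomes a condition on
its position. -/
theorem W_eq_span (n k i : ℕ) :
    W n k i = Submodule.span ℂ (elt n '' {p | p.1.1 = k ∧ p.1.2.2 = i}) := by
  unfold W
  congr 1
  ext v
  constructor
  · rintro ⟨⟨x, hx, l, h1, h2, rfl⟩, hi⟩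
    refine ⟨⟨(k, x, l), hx, h1, h2⟩, ⟨rfl, ?_⟩, rfl⟩
    exact eq_of_mem_level (elt_ne_zero ⟨(k, x, l), hx, h1, h2⟩) (elt_mem_level _) hi
  · rintro ⟨p, ⟨rfl, rfl⟩, rfl⟩
    exact ⟨⟨p.1.2.1, p.2.1, p.1.2.2, p.2.2.1, p.2.2.2, rfl⟩, elt_mem_level p⟩

theorem W_le_level (n k i : ℕ) : W n k i ≤ level n i :=
  Submodule.span_le.mpr fun _ hv => hv.2

theorem elt_mem_W {n : ℕ} (p : Index n) : elt n p ∈ W n p.1.1 p.1.2.2 := by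
  rw [W_eq_span]
  exact Submodule.subset_span ⟨p, ⟨rfl, rfl⟩, rfl⟩

theorem level_eq_span (n i : ℕ) :
    level n i = Submodule.span ℂ (elt n '' {p | p.1.2.2 = i}) := by
  refine le_antisymm (fun v hv => ?_) (Submodule.span_le.mpr ?_)
  · have h : Submodule.map (levelProj n i) ⊤ ≤
        Submodule.span ℂ (elt n '' {p | p.1.2.2 = i}) := by
      rw [← span_range_elt, Submodule.map_span_le]
      rintro _ ⟨p, rfl⟩
      by_cases hp : p.1.2.2 = i
      · rw [levelProj_of_mem (hp ▸ elt_mem_level p)]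
        exact Submodule.subset_span ⟨p, hp, rfl⟩
      · rw [levelProj_of_mem_of_ne (elt_mem_level p) hp]
        exact Submodule.zero_mem _
    exact h ⟨v, trivial, levelProj_of_mem hv⟩
  · rintro _ ⟨p, rfl, rfl⟩
    exact elt_mem_level p

theorem iSupIndep_W (n i : ℕ) :
    iSupIndep fun k : {k : ℕ // k ≤ i ∧ i + k ≤ n} => W n k i := by
  intro k
  have h : ⨆ j, ⨆ (_ : j ≠ k), W n j i ≤ Submodule.span ℂ (elt n '' {p | p.1.1 ≠ k.1}) := by
    refine iSup₂_le fun j hj => ?_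
    rw [W_eq_span]
    refine Submodule.span_mono (Set.image_mono ?_)
    rintro p ⟨hp, -⟩ h
    exact hj (Subtype.ext (hp.symm.trans h))
  refine Disjoint.mono_right h ?_
  change Disjoint (W n k i) _
  rw [W_eq_span]
  refine (linearIndependent_elt n).disjoint_span_image (Set.disjoint_left.mpr ?_)
  rintro p ⟨hp, -⟩ h
  exact h hp

theorem iSup_W (n i : ℕ) : ⨆ k : {k : ℕ // k ≤ i ∧ i + k ≤ n}, W n k i = level n i := by
  refine le_antisymm (iSup_le fun k => W_le_level n k i) ?_
  rw [level_eq_span, Submodule.span_le]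
  rintro _ ⟨p, rfl, rfl⟩
  exact le_iSup (fun k : {k : ℕ // k ≤ p.1.2.2 ∧ p.1.2.2 + k ≤ n} => W n k p.1.2.2)
    ⟨p.1.1, p.2.2⟩ (elt_mem_W p)

theorem sjb_nonempty {n k : ℕ} (h : 2 * k ≤ n) : (sjb n k).Nonempty := by
  induction n generalizing k with
  | zero => exact ⟨_, by omega, rfl⟩
  | succ n ih =>
    by_cases hk : 2 * k ≤ n
    · obtain ⟨x, hx⟩ := ih hk
      exact ⟨_, Or.inl ⟨x, hx, rfl⟩⟩
    -- Only `2k = n + 1` remains, and then `j = k - 1` satisfies `2j < n`.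
    · obtain ⟨j, rfl⟩ : ∃ j, k = j + 1 := ⟨k - 1, by omega⟩
      obtain ⟨x, hx⟩ := ih (k := j) (by omega)
      exact ⟨_, Or.inr ⟨j, rfl, by omega, x, hx, rfl⟩⟩

theorem exists_ne_zero_mem_W {n k i : ℕ} (hki : k ≤ i) (hin : i + k ≤ n) :
    ∃ v ∈ W n k i, v ≠ 0 := by
  obtain ⟨x, hx⟩ := sjb_nonempty (two_mul_le hki hin)
  exact ⟨_, elt_mem_W ⟨(k, x, i), hx, hki, hin⟩, elt_ne_zero _⟩

/-! ### Invariance of `W(n,k,i)` -/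

theorem IsUpChain.pow_up {n k : ℕ} {x : ℕ → V n} (hx : IsUpChain n k x) {l : ℕ} (hl : k ≤ l)
    (m : ℕ) : (up n ^ m) (x l) = x (l + m) := by
  induction m with
  | zero => rfl
  | succ m ih => rw [pow_succ', Module.End.mul_apply, ih, hx.up_eq _ (by omega), add_assoc]

theorem pow_up_elt {n : ℕ} (p : Index n) (m : ℕ) :
    (up n ^ m) (elt n p) = p.1.2.1 (p.1.2.2 + m) :=
  (isUpChain_of_mem_sjb p.2.1).pow_up p.2.2.1 m

/-- The operator moves each position in `s` by `m` steps along its own chain without leaving it, so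
it carries these basis elements injectively to basis elements. -/
theorem disjoint_span_ker_pow_up {n : ℕ} (m : ℕ) (s : Set (Index n))
    (hs : ∀ p ∈ s, p.1.2.2 + m + p.1.1 ≤ n) :
    Disjoint (Submodule.span ℂ (elt n '' s)) (LinearMap.ker (up n ^ m)) := by
  let sh : s → Index n := fun p =>
    ⟨(p.1.1.1, p.1.1.2.1, p.1.1.2.2 + m), p.1.2.1, p.1.2.2.1.trans (Nat.le_add_right _ _), hs p p.2⟩
  have hsh : Function.Injective sh := by
    rintro ⟨⟨⟨k, x, l⟩, hp⟩, h⟩ ⟨⟨⟨k', x', l'⟩, hp'⟩, h'⟩ h2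
    simpa [sh] using h2
  have hli : LinearIndependent ℂ ((up n ^ m) ∘ fun p : s => elt n p) := by
    have h : ((up n ^ m) ∘ fun p : s => elt n p) = elt n ∘ sh :=
      funext fun p => pow_up_elt p.1 m
    rw [h]
    exact (linearIndependent_elt n).comp sh hsh
  rw [Set.image_eq_range]
  exact Submodule.range_ker_disjoint hli

theorem disjoint_W_ker_pow_up {n k i : ℕ} (hki : k ≤ i) (hin : i + k ≤ n) :
    Disjoint (W n k k) (LinearMap.ker (up n ^ (i - k))) := by
  rw [W_eq_span]
  refine disjoint_span_ker_pow_up _ _ ?_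
  rintro p ⟨h1, h2⟩
  omega

/-- From rank `k`, `n - 2k + 1` steps just pass the end of a chain starting at `k`, while a chain
starting at `j < k` still has entries there. The resulting description no longer mentions `J(n)`,
which is what makes invariance visible. -/
theorem mem_W_self_iff {n k : ℕ} (h : 2 * k ≤ n) {v : V n} :
    v ∈ W n k k ↔ v ∈ level n k ∧ (up n ^ (n - 2 * k + 1)) v = 0 := by
  have h0 : W n k k ≤ LinearMap.ker (up n ^ (n - 2 * k + 1)) := by
    rw [W_eq_span, Submodule.span_le]
    rintro _ ⟨p, ⟨h1, h2⟩, rfl⟩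
    change _ = _
    rw [pow_up_elt, (isUpChain_of_mem_sjb p.2.1).eq_zero _ (by omega)]
  refine ⟨fun hv => ⟨W_le_level _ _ _ hv, h0 hv⟩, ?_⟩
  rintro ⟨hv, hv0⟩
  have h1 : level n k = W n k k ⊔
      Submodule.span ℂ (elt n '' {p | p.1.1 < k ∧ p.1.2.2 = k}) := by
    rw [level_eq_span, W_eq_span, ← Submodule.span_union, ← Set.image_union]
    congr 2
    ext p
    have := p.2.2.1
    simp only [Set.mem_ofPred_eq, Set.mem_union]
    omega
  rw [h1] at hv
  obtain ⟨w, hw, u, hu, rfl⟩ := Submodule.mem_sup.mp hv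
  have hu0 : u = 0 := by
    refine Submodule.disjoint_def.mp (disjoint_span_ker_pow_up (n - 2 * k + 1) _ ?_) u hu ?_
    · rintro p ⟨h1, h2⟩
      omega
    · rw [map_add, LinearMap.mem_ker.mp (h0 hw), zero_add] at hv0
      exact hv0
  rwa [hu0, add_zero]

theorem W_eq_map {n k i : ℕ} (hki : k ≤ i) (hin : i + k ≤ n) :
    W n k i = (W n k k).map (up n ^ (i - k)) := by
  rw [W_eq_span, W_eq_span, Submodule.map_span, ← Set.image_comp]
  congr 1
  ext v
  constructor
  · rintro ⟨p, ⟨h1, h2⟩, rfl⟩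
    refine ⟨⟨(p.1.1, p.1.2.1, p.1.1), p.2.1, le_rfl, by dsimp only; omega⟩, ⟨h1, h1⟩, ?_⟩
    rw [Function.comp_apply, pow_up_elt]
    exact congrArg p.1.2.1 (show p.1.1 + (i - k) = p.1.2.2 by omega)
  · rintro ⟨p, ⟨h1, h2⟩, rfl⟩
    refine ⟨⟨(p.1.1, p.1.2.1, i), p.2.1, by dsimp only; omega, by dsimp only; omega⟩,
      ⟨h1, rfl⟩, ?_⟩
    rw [Function.comp_apply, pow_up_elt]
    exact congrArg p.1.2.1 (show i = p.1.2.2 + (i - k) by omega)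

theorem boolRep_mem_W {n k i : ℕ} (hki : k ≤ i) (hin : i + k ≤ n) (g : Equiv.Perm (Fin n))
    {v : V n} (hv : v ∈ W n k i) : boolRep n g v ∈ W n k i := by
  rw [W_eq_map hki hin] at hv ⊢
  obtain ⟨w, hw, rfl⟩ := hv
  refine ⟨boolRep n g w, ?_, pow_up_boolRep g _ w⟩
  have h : 2 * k ≤ n := two_mul_le hki hin
  have h1 := (mem_W_self_iff h).mp hw
  refine (mem_W_self_iff h).mpr ⟨boolRep_mem_level g h1.1, ?_⟩
  rw [pow_up_boolRep, h1.2, map_zero]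

/-! ### The commutant of a level -/

/-- If two pairs of subsets have the same cardinalities and the same cardinality of the
intersection, then some permutation carries one pair to the other. -/
theorem exists_perm_map_eq {α : Type*} [Fintype α] [DecidableEq α] {X Y X' Y' : Finset α}
    (hX : X.card = X'.card) (hY : Y.card = Y'.card) (hXY : (X ∩ Y).card = (X' ∩ Y').card) :
    ∃ g : Equiv.Perm α, X.map g.toEmbedding = X' ∧ Y.map g.toEmbedding = Y' := by
  -- Each pair cuts the ground set into four regions, whose sizes are determined by the three given
  -- cardinalities; `g` matches region with region.
  have hcard : ∀ c : Bool × Bool, Fintype.card {x // (decide (x ∈ X), decide (x ∈ Y)) = c} =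
      Fintype.card {x // (decide (x ∈ X'), decide (x ∈ Y')) = c} := by
    have h1 := Finset.card_inter_add_card_sdiff X Y
    have h1' := Finset.card_inter_add_card_sdiff X' Y'
    have h2 := Finset.card_inter_add_card_sdiff Y X
    have h2' := Finset.card_inter_add_card_sdiff Y' X'
    have h3 := Finset.card_union_add_card_inter X Y
    have h3' := Finset.card_union_add_card_inter X' Y'
    have h4 := Finset.card_add_card_compl (X ∪ Y)
    have h4' := Finset.card_add_card_compl (X' ∪ Y')
    rw [Finset.inter_comm Y X] at h2
    rw [Finset.inter_comm Y' X'] at h2'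
    have key : ∀ (F : Finset α → Finset α → Finset α) (c : Bool × Bool),
        (∀ X Y x, x ∈ F X Y ↔ (decide (x ∈ X), decide (x ∈ Y)) = c) →
        (F X Y).card = (F X' Y').card →
        Fintype.card {x // (decide (x ∈ X), decide (x ∈ Y)) = c} =
          Fintype.card {x // (decide (x ∈ X'), decide (x ∈ Y')) = c} := by
      intro F c hF h
      rw [Fintype.card_of_subtype (F X Y) (hF X Y), Fintype.card_of_subtype (F X' Y') (hF X' Y'), h]
    rintro ⟨_ | _, _ | _⟩
    · exact key (fun X Y => (X ∪ Y)ᶜ) _ (fun X Y x => by simp) (by omega)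
    · exact key (fun X Y => Y \ X) _ (fun X Y x => by simp [and_comm]) (by omega)
    · exact key (fun X Y => X \ Y) _ (fun X Y x => by simp) (by omega)
    · exact key (fun X Y => X ∩ Y) _ (fun X Y x => by simp) (by omega)
  let e := Equiv.ofFiberEquiv fun c => Fintype.equivOfCardEq (hcard c)
  have he : ∀ x, (decide (e x ∈ X'), decide (e x ∈ Y')) = (decide (x ∈ X), decide (x ∈ Y)) :=
    Equiv.ofFiberEquiv_map fun c => Fintype.equivOfCardEq (hcard c)
  simp only [Prod.mk.injEq, decide_eq_decide] at he
  refine ⟨e, ?_, ?_⟩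
  · ext x
    rw [Finset.mem_map_equiv, ← (he _).1, Equiv.apply_symm_apply]
  · ext x
    rw [Finset.mem_map_equiv, ← (he _).2, Equiv.apply_symm_apply]

/-- The operators on `V(B(n))` that commute with `S_n`, map into `V(B(n)_i)`, and vanish on the
other levels: a copy of the algebra of endomorphisms of the `S_n`-module `V(B(n)_i)`. -/
def commutant (n i : ℕ) : Submodule ℂ (V n →ₗ[ℂ] V n) where
  carrier := {T | (∀ g v, T (boolRep n g v) = boolRep n g (T v)) ∧ (∀ v, T v ∈ level n i) ∧
    ∀ v, T (levelProj n i v) = T v}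
  add_mem' hS hT := ⟨fun g v => by simp [hS.1 g v, hT.1 g v],
    fun v => Submodule.add_mem _ (hS.2.1 v) (hT.2.1 v), fun v => by simp [hS.2.2 v, hT.2.2 v]⟩
  zero_mem' := ⟨by simp, fun _ => Submodule.zero_mem _, by simp⟩
  smul_mem' c T hT := ⟨fun g v => by simp [hT.1 g v],
    fun v => Submodule.smul_mem _ _ (hT.2.1 v), fun v => by simp [hT.2.2 v]⟩

/-- The operator sending `X` with `|X| = i` to the sum of all `Y` with `|Y| = i` and
`|X ∩ Y| = j`. -/
def orbitOp (n i j : ℕ) : V n →ₗ[ℂ] V n :=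
  Finsupp.linearCombination ℂ fun X : Finset (Fin n) =>
    Finsupp.equivFunOnFinite.symm fun Y =>
      if X.card = i ∧ Y.card = i ∧ (X ∩ Y).card = j then 1 else 0

theorem orbitOp_single_apply (n i j : ℕ) (X Y : Finset (Fin n)) :
    orbitOp n i j (Finsupp.single X 1) Y =
      if X.card = i ∧ Y.card = i ∧ (X ∩ Y).card = j then 1 else 0 := by
  rw [orbitOp, Finsupp.linearCombination_single, one_smul]
  rfl

open Classical in
-- The matrix entries of an equivariant operator are constant on the orbits of `S_n` on pairs of
-- `i`-sets, and such an orbit is determined by the size of the intersection.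
theorem commutant_le_span_orbitOp (n i : ℕ) :
    commutant n i ≤ Submodule.span ℂ
      (Set.range fun j : Finset.Icc (2 * i - n) i => orbitOp n i j) := by
  rintro T ⟨hcomm, hrange, hproj⟩
  have hinv : ∀ X Y X' Y' : Finset (Fin n), X.card = X'.card → Y.card = Y'.card →
      (X ∩ Y).card = (X' ∩ Y').card →
      T (Finsupp.single X 1) Y = T (Finsupp.single X' 1) Y' := by
    intro X Y X' Y' h1 h2 h3
    obtain ⟨g, rfl, rfl⟩ := exists_perm_map_eq h1 h2 h3
    rw [← boolRep_single, hcomm, boolRep_apply_map]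
  let c : ℕ → ℂ := fun j =>
    if h : ∃ p : Finset (Fin n) × Finset (Fin n),
      p.1.card = i ∧ p.2.card = i ∧ (p.1 ∩ p.2).card = j
    then T (Finsupp.single h.choose.1 1) h.choose.2 else 0
  have hc : ∀ X Y : Finset (Fin n), X.card = i → Y.card = i →
      c (X ∩ Y).card = T (Finsupp.single X 1) Y := by
    intro X Y h1 h2
    have h : ∃ p : Finset (Fin n) × Finset (Fin n),
      p.1.card = i ∧ p.2.card = i ∧ (p.1 ∩ p.2).card = (X ∩ Y).card := ⟨(X, Y), h1, h2, rfl⟩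
    have hs := h.choose_spec
    rw [show c (X ∩ Y).card = _ from dif_pos h]
    exact hinv _ _ _ _ (hs.1.trans h1.symm) (hs.2.1.trans h2.symm) hs.2.2
  have hT : T = ∑ j : Finset.Icc (2 * i - n) i, c j • orbitOp n i j := by
    refine Finsupp.lhom_ext' fun X => LinearMap.ext_ring (Finsupp.ext fun Y => ?_)
    simp only [LinearMap.comp_apply, Finsupp.lsingle_apply, LinearMap.sum_apply,
      LinearMap.smul_apply, Finsupp.finsetSum_apply, Finsupp.smul_apply, orbitOp_single_apply,
      smul_eq_mul, mul_ite, mul_one, mul_zero]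
    by_cases hX : X.card = i
    · by_cases hY : Y.card = i
      -- The lower bound comes from `|X ∪ Y| ≤ n`; truncated subtraction makes it `max(0, 2i - n)`.
      · have h1 : (X ∩ Y).card ∈ Finset.Icc (2 * i - n) i := by
          have h2 := Finset.card_union_add_card_inter X Y
          have h3 := Finset.card_le_univ (X ∪ Y)
          have h4 := Finset.card_le_card (Finset.inter_subset_left (s₁ := X) (s₂ := Y))
          rw [Fintype.card_fin] at h3
          rw [Finset.mem_Icc]
          omega
        rw [Finset.sum_eq_single (⟨_, h1⟩ : Finset.Icc (2 * i - n) i)]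
        · rw [if_pos ⟨hX, hY, rfl⟩, hc X Y hX hY]
        · intro j _ hj
          refine if_neg ?_
          rintro ⟨-, -, h⟩
          exact hj (Subtype.ext h.symm)
        · exact fun h => absurd (Finset.mem_univ _) h
      · rw [Finset.sum_eq_zero fun j _ => if_neg fun h => hY h.2.1]
        by_contra h
        exact hY (mem_level.mp (hrange _) Y h)
    · rw [Finset.sum_eq_zero fun j _ => if_neg fun h => hX h.1, ← hproj,
        levelProj_of_mem_of_ne (single_mem_level X 1) hX, map_zero, Finsupp.zero_apply]
  rw [hT]
  exact Submodule.sum_mem _ fun j _ => Submodule.smul_mem _ _ (Submodule.subset_span ⟨j, rfl⟩)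

theorem finrank_commutant_le (n i : ℕ) :
    Module.finrank ℂ (commutant n i) ≤ i + 1 - (2 * i - n) := by
  refine (Submodule.finrank_mono (commutant_le_span_orbitOp n i)).trans ?_
  refine (finrank_range_le_card _).trans ?_
  rw [Fintype.card_coe, Nat.card_Icc]

/-! ### The commutant is spanned by the projections onto the `W(n,k,i)` -/

theorem projection_apply_comm {R E : Type*} [Ring R] [AddCommGroup E] [Module R E]
    {p q : Submodule R E} (h : IsCompl p q) (T : E →ₗ[R] E) (hp : ∀ v ∈ p, T v ∈ p)
    (hq : ∀ v ∈ q, T v ∈ q) (v : E) : p.projection q h (T v) = T (p.projection q h v) := by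
  obtain ⟨a, ha, b, hb, rfl⟩ := Submodule.mem_sup.mp (h.sup_eq_top ▸ Submodule.mem_top (x := v))
  rw [map_add, map_add, map_add, Submodule.projection_apply_of_mem_left h (hp a ha),
    Submodule.projection_apply_of_mem_left h ha,
    (Submodule.projection_apply_eq_zero_iff h).mpr (hq b hb),
    (Submodule.projection_apply_eq_zero_iff h).mpr hb, add_zero, add_zero]

theorem projection_comp_levelProj_mem_commutant {n i : ℕ} {p q : Submodule ℂ (V n)}
    (h : IsCompl p q) (hp : ∀ g, ∀ v ∈ p, boolRep n g v ∈ p)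
    (hq : ∀ g, ∀ v ∈ q, boolRep n g v ∈ q) (hi : p ≤ level n i) :
    p.projection q h ∘ₗ levelProj n i ∈ commutant n i :=
  ⟨fun g v => by
    rw [LinearMap.comp_apply, levelProj_boolRep, projection_apply_comm h _ (hp g) (hq g)]
    rfl, fun v => hi (Submodule.projection_apply_mem h _),
    fun v => by rw [LinearMap.comp_apply, levelProj_of_mem (levelProj_mem v)]; rfl⟩

theorem isCompl_W (n k i : ℕ) : IsCompl (W n k i)
    (Submodule.span ℂ (elt n '' {p | p.1.1 = k ∧ p.1.2.2 = i}ᶜ)) := by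
  rw [W_eq_span]
  exact (linearIndependent_elt n).isCompl_span_image (span_range_elt n) isCompl_compl

/-- The projection onto `W(n,k,i)` along the span of the other elements of the basis `J(n)`. -/
def projW (n k i : ℕ) : V n →ₗ[ℂ] V n :=
  (W n k i).projection _ (isCompl_W n k i) ∘ₗ levelProj n i

theorem projW_of_mem {n k i : ℕ} {v : V n} (hv : v ∈ W n k i) : projW n k i v = v := by
  rw [projW, LinearMap.comp_apply, levelProj_of_mem (W_le_level _ _ _ hv),
    Submodule.projection_apply_of_mem_left _ hv]

theorem projW_of_mem_of_ne {n k j i : ℕ} {v : V n} (hv : v ∈ W n j i) (h : j ≠ k) :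
    projW n k i v = 0 := by
  rw [projW, LinearMap.comp_apply, levelProj_of_mem (W_le_level _ _ _ hv),
    Submodule.projection_apply_eq_zero_iff]
  rw [W_eq_span] at hv
  refine Submodule.span_mono (Set.image_mono ?_) hv
  rintro p ⟨hp, -⟩ ⟨hp', -⟩
  exact h (hp.symm.trans hp')

theorem projW_mem_commutant {n k i : ℕ} (hki : k ≤ i) (hin : i + k ≤ n) :
    projW n k i ∈ commutant n i := by
  refine projection_comp_levelProj_mem_commutant _ (fun g v => boolRep_mem_W hki hin g) ?_
    (W_le_level n k i)
  intro g
  change _ ≤ (Submodule.span ℂ _).comap (boolRep n g)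
  rw [Submodule.span_le]
  rintro _ ⟨p, hp, rfl⟩
  -- A basis element outside `W n k i` lies in another invariant `W n j l`, spanned by elements that
  -- are all outside `W n k i`.
  have h := boolRep_mem_W p.2.2.1 p.2.2.2 g (elt_mem_W p)
  rw [W_eq_span] at h
  refine Submodule.span_mono (Set.image_mono ?_) h
  rintro q ⟨hq1, hq2⟩ ⟨hq3, hq4⟩
  exact hp ⟨hq1.symm.trans hq3, hq2.symm.trans hq4⟩

theorem card_starting_ranks {n i : ℕ} (hi : i ≤ n) :
    Nat.card {k : ℕ // k ≤ i ∧ i + k ≤ n} = i + 1 - (2 * i - n) := by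
  have h : ∀ k, k ≤ i ∧ i + k ≤ n ↔ k ∈ Finset.range (i + 1 - (2 * i - n)) := by
    intro k
    rw [Finset.mem_range]
    omega
  rw [Nat.card_congr (Equiv.subtypeEquivRight h), Nat.card_eq_fintype_card, Fintype.card_coe,
    Finset.card_range]

instance finite_starting_ranks (n i : ℕ) : Finite {k : ℕ // k ≤ i ∧ i + k ≤ n} :=
  Set.Finite.to_subtype ((Set.finite_Iic i).subset fun _ h => h.1)

theorem linearIndependent_projW (n i : ℕ) :
    LinearIndependent ℂ fun k : {k : ℕ // k ≤ i ∧ i + k ≤ n} => projW n k i := by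
  refine (linearIndependent_iff' (R := ℂ) (M := V n →ₗ[ℂ] V n)).mpr ?_
  intro s c hc k hk
  obtain ⟨v, hv, hv0⟩ := exists_ne_zero_mem_W k.2.1 k.2.2
  have h := LinearMap.congr_fun hc v
  rw [LinearMap.sum_apply, Finset.sum_eq_single k, LinearMap.smul_apply, projW_of_mem hv,
    LinearMap.zero_apply] at h
  · exact (smul_eq_zero.mp h).resolve_right hv0
  · intro j _ hj
    rw [LinearMap.smul_apply, projW_of_mem_of_ne hv fun h => hj (Subtype.ext h.symm), smul_zero]
  · exact fun h => absurd hk h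

/-- The upper bound from intersection sizes meets the lower bound from independent projections: both
are `min(i, n - i) + 1`. -/
theorem commutant_eq_span_projW {n i : ℕ} (hi : i ≤ n) :
    commutant n i = Submodule.span ℂ
      (Set.range fun k : {k : ℕ // k ≤ i ∧ i + k ≤ n} => projW n k i) := by
  have := Fintype.ofFinite {k : ℕ // k ≤ i ∧ i + k ≤ n}
  symm
  refine Submodule.eq_of_le_of_finrank_le (K := ℂ) (V := V n →ₗ[ℂ] V n)
    (Submodule.span_le.mpr ?_) ?_
  · rintro _ ⟨k, rfl⟩
    exact projW_mem_commutant k.2.1 k.2.2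
  · refine (finrank_commutant_le n i).trans (le_of_eq ?_)
    rw [← card_starting_ranks hi, Nat.card_eq_fintype_card]
    exact (finrank_span_eq_card (R := ℂ) (M := V n →ₗ[ℂ] V n)
      (linearIndependent_projW n i)).symm

/-- Each spanning projection is the identity or zero on `W n k i`. This conclusion of Schur's lemma
is thus obtained before irreducibility and serves to prove it. -/
theorem exists_smul_of_mem_commutant {n i : ℕ} (hi : i ≤ n) {T : V n →ₗ[ℂ] V n}
    (hT : T ∈ commutant n i) (k : ℕ) : ∃ c : ℂ, ∀ v ∈ W n k i, T v = c • v := by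
  rw [commutant_eq_span_projW hi] at hT
  induction hT using Submodule.span_induction with
  | mem T hT =>
    obtain ⟨j, rfl⟩ := hT
    by_cases h : k = j
    · exact ⟨1, fun v hv => by rw [one_smul, projW_of_mem (h ▸ hv)]⟩
    · exact ⟨0, fun v hv => by rw [zero_smul, projW_of_mem_of_ne hv h]⟩
  | zero => exact ⟨0, by simp⟩
  | add S T _ _ hS hT =>
    obtain ⟨a, ha⟩ := hS
    obtain ⟨b, hb⟩ := hT
    exact ⟨a + b, fun v hv => by rw [LinearMap.add_apply, ha v hv, hb v hv, add_smul]⟩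
  | smul c T _ hT =>
    obtain ⟨a, ha⟩ := hT
    exact ⟨c * a, fun v hv => by rw [LinearMap.smul_apply, ha v hv, mul_smul]⟩

theorem commutant_comm {n i : ℕ} (hi : i ≤ n) {S T : V n →ₗ[ℂ] V n}
    (hS : S ∈ commutant n i) (hT : T ∈ commutant n i) (v : V n) : S (T v) = T (S v) := by
  suffices h : S ∘ₗ T = T ∘ₗ S from LinearMap.congr_fun h v
  refine LinearMap.ext_on_range (span_range_elt n) fun p => ?_
  rw [LinearMap.comp_apply, LinearMap.comp_apply]
  by_cases hp : p.1.2.2 = i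
  · obtain ⟨a, ha⟩ := exists_smul_of_mem_commutant hi hS p.1.1
    obtain ⟨b, hb⟩ := exists_smul_of_mem_commutant hi hT p.1.1
    have h := elt_mem_W p
    rw [hp] at h
    rw [ha _ h, hb _ h, map_smul, map_smul, ha _ h, hb _ h, smul_comm]
  · rw [← hT.2.2 (elt n p), ← hS.2.2 (elt n p), levelProj_of_mem_of_ne (elt_mem_level p) hp]
    simp

/-! ### Irreducibility and multiplicity freeness -/

/-- Maschke's theorem, in the form that the lattice of subrepresentations is complemented. -/
theorem exists_isCompl_invariant {n : ℕ} (N : Submodule ℂ (V n))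
    (hN : ∀ g, ∀ v ∈ N, boolRep n g v ∈ N) :
    ∃ N' : Submodule ℂ (V n), IsCompl N N' ∧ ∀ g, ∀ v ∈ N', boolRep n g v ∈ N' := by
  obtain ⟨Q, hQ⟩ := exists_isCompl (⟨N, hN⟩ : Subrepresentation (boolRep n))
  refine ⟨Q.toSubmodule, ⟨?_, ?_⟩, Q.apply_mem_toSubmodule⟩
  · rw [disjoint_iff]
    exact congrArg Subrepresentation.toSubmodule hQ.inf_eq_bot
  · rw [codisjoint_iff]
    exact congrArg Subrepresentation.toSubmodule hQ.sup_eq_top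

theorem exists_projection_mem_commutant {n i : ℕ} {N : Submodule ℂ (V n)}
    (hN : ∀ g, ∀ v ∈ N, boolRep n g v ∈ N) (hi : N ≤ level n i) :
    ∃ P ∈ commutant n i, (∀ v, P v ∈ N) ∧ ∀ v ∈ N, P v = v := by
  obtain ⟨N', h, hN'⟩ := exists_isCompl_invariant N hN
  refine ⟨_, projection_comp_levelProj_mem_commutant h hN hN' hi,
    fun v => Submodule.projection_apply_mem h _, fun v hv => ?_⟩
  rw [LinearMap.comp_apply, levelProj_of_mem (hi hv), Submodule.projection_apply_of_mem_left h hv]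

/-- An equivariant projection onto `N` is a scalar on `W n k i`; it fixes a nonzero vector of `N`,
so the scalar is `1` and all of `W n k i` lies in its image `N`. -/
theorem eq_W_of_invariant {n k i : ℕ} (hi : i ≤ n) {N : Submodule ℂ (V n)}
    (hN : ∀ g, ∀ v ∈ N, boolRep n g v ∈ N) (hNW : N ≤ W n k i) (hN0 : N ≠ ⊥) : N = W n k i := by
  obtain ⟨P, hP, hPN, hPv⟩ := exists_projection_mem_commutant hN (hNW.trans (W_le_level n k i))
  obtain ⟨c, hc⟩ := exists_smul_of_mem_commutant hi hP k
  obtain ⟨v, hv, hv0⟩ := N.exists_mem_ne_zero_of_ne_bot hN0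
  have h1 : c = 1 := by
    have h := (hc v (hNW hv)).symm.trans (hPv v hv)
    exact smul_left_injective ℂ hv0 (h.trans (one_smul ℂ v).symm)
  refine le_antisymm hNW fun w hw => ?_
  have h := hPN w
  rwa [hc w hw, h1, one_smul] at h

theorem isIrreducible_W {n k i : ℕ} (hki : k ≤ i) (hin : i + k ≤ n)
    (hW : ∀ g : Equiv.Perm (Fin n), W n k i ≤ (W n k i).comap (boolRep n g)) :
    Representation.IsIrreducible (k := ℂ) (V := W n k i)
      ((boolRep n).subrepresentation (W n k i) hW) := by
  have hmap : ∀ Q : Subrepresentation ((boolRep n).subrepresentation (W n k i) hW),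
      ∀ g, ∀ v ∈ Q.toSubmodule.map (W n k i).subtype,
        boolRep n g v ∈ Q.toSubmodule.map (W n k i).subtype := by
    rintro Q g _ ⟨w, hw, rfl⟩
    exact ⟨_, Q.apply_mem_toSubmodule g hw, rfl⟩
  have hnt : Nontrivial (Subrepresentation ((boolRep n).subrepresentation (W n k i) hW)) := by
    obtain ⟨v, hv, hv0⟩ := exists_ne_zero_mem_W hki hin
    refine ⟨⊥, ⊤, fun h => hv0 ?_⟩
    have h1 : (⟨v, hv⟩ : W n k i) ∈ (⊥ : Submodule ℂ (W n k i)) := by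
      have h2 : (⊥ : Submodule ℂ (W n k i)) = ⊤ := congrArg Subrepresentation.toSubmodule h
      rw [h2]
      trivial
    exact congrArg Subtype.val ((Submodule.mem_bot ℂ).mp h1)
  refine { toNontrivial := hnt, eq_bot_or_eq_top := fun Q => ?_ }
  by_cases hQ : Q.toSubmodule.map (W n k i).subtype = ⊥
  · left
    refine Subrepresentation.toSubmodule_injective ?_
    exact Submodule.map_injective_of_injective (W n k i).injective_subtype
      (hQ.trans (Submodule.map_bot _).symm)
  · right
    refine Subrepresentation.toSubmodule_injective ?_
    have h := eq_W_of_invariant (by omega) (hmap Q) (Submodule.map_subtype_le _ _) hQ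
    refine Submodule.map_injective_of_injective (W n k i).injective_subtype ?_
    rw [h]
    exact (Submodule.map_subtype_top _).symm

/-- A nonzero `f` embeds `M` as the image of an equivariant projection `P`. For another `g`,
commutativity of the commutant forces the image of `g` into that of `f`, and Schur's lemma makes `g`
a multiple of `f`. -/
theorem rank_intertwiningMap_le_one {n i : ℕ} (hi : i ≤ n) {M E : Type} [AddCommGroup M]
    [Module ℂ M] [AddCommGroup E] [Module ℂ E] (σ : Representation ℂ (Equiv.Perm (Fin n)) M)
    (ρ : Representation ℂ (Equiv.Perm (Fin n)) E) (hσ : σ.IsIrreducible) (emb : E →ₗ[ℂ] V n)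
    (hemb : Function.Injective emb) (hcomm : ∀ g v, emb (ρ g v) = boolRep n g (emb v))
    (hlevel : ∀ v, emb v ∈ level n i) : Module.rank ℂ (σ.IntertwiningMap ρ) ≤ 1 := by
  refine rank_le_one_iff.mpr ?_
  by_cases h0 : ∀ f : σ.IntertwiningMap ρ, f = 0
  · exact ⟨0, fun f => ⟨0, by rw [h0 f, smul_zero]⟩⟩
  push Not at h0
  obtain ⟨f, hf⟩ := h0
  have hinj := (Representation.IsIrreducible.injective_or_eq_zero f).resolve_right hf
  let F : M →ₗ[ℂ] V n := emb ∘ₗ f.toLinearMap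
  have hF : Function.Injective F := hemb.comp hinj
  have hFg : ∀ g v, F (σ g v) = boolRep n g (F v) := fun g v =>
    (congrArg emb (f.isIntertwining _ _ g v)).trans (hcomm g _)
  have : FiniteDimensional ℂ M := FiniteDimensional.of_injective F hF
  obtain ⟨P, hP, hPN, hPv⟩ := exists_projection_mem_commutant (i := i) (N := LinearMap.range F)
    (by rintro g _ ⟨v, rfl⟩; exact ⟨σ g v, hFg g v⟩) (by rintro _ ⟨v, rfl⟩; exact hlevel _)
  let e := LinearEquiv.ofInjective F hF
  let r : V n →ₗ[ℂ] M := e.symm.toLinearMap ∘ₗ P.codRestrict (LinearMap.range F) hPN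
  have hFr : ∀ v, F (r v) = P v := fun v =>
    congrArg Subtype.val (e.apply_symm_apply (P.codRestrict (LinearMap.range F) hPN v))
  have hrF : ∀ v, r (F v) = v := fun v => hF (by rw [hFr, hPv _ ⟨v, rfl⟩])
  have hrg : ∀ g v, r (boolRep n g v) = σ g (r v) := fun g v =>
    hF (by rw [hFr, hFg, hFr, hP.1])
  refine ⟨f, fun g => ?_⟩
  let G : M →ₗ[ℂ] V n := emb ∘ₗ g.toLinearMap
  have hGg : ∀ a v, G (σ a v) = boolRep n a (G v) := fun a v =>
    (congrArg emb (g.isIntertwining _ _ a v)).trans (hcomm a _)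
  have hT : G ∘ₗ r ∈ commutant n i := by
    refine ⟨fun a v => ?_, fun v => hlevel _, fun v => ?_⟩
    · rw [LinearMap.comp_apply, hrg, hGg]
      rfl
    · refine congrArg G (hF ?_)
      rw [hFr, hFr, hP.2.2]
  -- Evaluate the commutation of `P` with `G ∘ₗ r` at `F v`, which `P` fixes and `r` sends to `v`.
  have hGP : ∀ v, P (G v) = G v := by
    intro v
    have h := commutant_comm hi hP hT (F v)
    rw [hPv _ ⟨v, rfl⟩, LinearMap.comp_apply, hrF] at h
    exact h
  let s : σ.IntertwiningMap σ := (r ∘ₗ G).intertwiningMap_of_isIntertwiningMap σ σ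
    fun a v => by rw [LinearMap.comp_apply, hGg, hrg]; rfl
  obtain ⟨c, hc⟩ :=
    (Representation.IsIrreducible.algebraMap_intertwiningMap_bijective_of_isAlgClosed).2 s
  refine ⟨c, Representation.IntertwiningMap.ext (LinearMap.ext fun v => hemb ?_)⟩
  have h1 : r (G v) = c • v := by
    have h2 : s v = (algebraMap ℂ (σ.IntertwiningMap σ) c) v := by rw [hc]
    exact h2
  change emb (c • f v) = G v
  rw [map_smul]
  change c • F v = G v
  rw [← hGP v, ← hFr, h1, map_smul]

theorem isMultiplicityFree_level {n i : ℕ} (hi : i ≤ n) :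
    IsMultiplicityFree (levelSub n i).toRepresentation := fun _ _ _ σ hσ =>
  rank_intertwiningMap_le_one (E := level n i) hi σ (levelSub n i).toRepresentation hσ
    (level n i).subtype (level n i).injective_subtype (fun _ _ => rfl) fun v => v.2

/-! ### Specht modules of two-row shapes -/

theorem mem_twoRow {n k : ℕ} (h : 2 * k ≤ n) {c : ℕ × ℕ} :
    c ∈ (twoRow n k h).cells ↔ c.1 = 0 ∧ c.2 < n - k ∨ c.1 = 1 ∧ c.2 < k := by
  rw [YoungDiagram.mem_cells, twoRow, YoungDiagram.mem_ofRowLens]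
  obtain ⟨_ | _ | a, b⟩ := c <;> simp

theorem nonempty_tableau {n k : ℕ} (h : 2 * k ≤ n) : Nonempty (Tableau n (twoRow n k h)) := by
  refine ⟨Fintype.equivOfCardEq ?_⟩
  have h1 : (twoRow n k h).cells =
      ({0} ×ˢ Finset.range (n - k) : Finset (ℕ × ℕ)) ∪ {1} ×ˢ Finset.range k := by
    ext c
    rw [mem_twoRow]
    simp only [Finset.mem_union, Finset.mem_product, Finset.mem_singleton, Finset.mem_range]
  rw [Fintype.card_coe, Fintype.card_fin, h1, Finset.card_union_of_disjoint]
  · simp only [Finset.card_product, Finset.card_singleton, Finset.card_range]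
    omega
  · rw [Finset.disjoint_left]
    intro c
    simp only [Finset.mem_product, Finset.mem_singleton]
    omega

/-- The elements placed in the second row. -/
def secondRow {n : ℕ} (f : Fin n → ℕ) : Finset (Fin n) := Finset.univ.filter fun x => f x = 1

theorem mem_secondRow {n : ℕ} {f : Fin n → ℕ} {x : Fin n} : x ∈ secondRow f ↔ f x = 1 := by
  rw [secondRow, Finset.mem_filter_univ]

/-- The map sending a tabloid to the set of elements in its second row. -/
def secondRowMap (n : ℕ) : ((Fin n → ℕ) →₀ ℂ) →ₗ[ℂ] V n := Finsupp.lmapDomain ℂ ℂ secondRow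

theorem secondRowMap_rowRep {n : ℕ} (g : Equiv.Perm (Fin n)) (v : (Fin n → ℕ) →₀ ℂ) :
    secondRowMap n (rowRep n g v) = boolRep n g (secondRowMap n v) := by
  induction v using Finsupp.induction_linear with
  | zero => simp
  | add v w hv hw => simp only [map_add, hv, hw]
  | single f c =>
    simp only [secondRowMap, rowRep, MonoidHom.coe_mk, OneHom.coe_mk, Finsupp.lmapDomain_apply,
      Finsupp.mapDomain_single, boolRep_single]
    congr 1
    ext x
    simp [secondRow, Finset.mem_map_equiv, Equiv.Perm.inv_def]

open Classical in
/-- The column antisymmetrizer of a tableau, acting on `V(B(n))`. -/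
def colAntisymm {n : ℕ} {μ : YoungDiagram} (t : Tableau n μ) : V n →ₗ[ℂ] V n :=
  ∑ σ : Equiv.Perm (Fin n) with ∀ x, (t (σ x)).1.2 = (t x).1.2,
    ((Equiv.Perm.sign σ : ℤ) : ℂ) • boolRep n σ

theorem secondRowMap_polytabloid {n : ℕ} {μ : YoungDiagram} (t : Tableau n μ) :
    secondRowMap n (polytabloid t) =
      colAntisymm t (Finsupp.single (secondRow (tabloid t)) 1) := by
  rw [polytabloid, colAntisymm, map_sum, LinearMap.sum_apply]
  refine Finset.sum_congr rfl fun σ _ => ?_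
  rw [map_smul, secondRowMap_rowRep, LinearMap.smul_apply]
  congr 2
  exact Finsupp.mapDomain_single

theorem colAntisymm_pow_up {n : ℕ} {μ : YoungDiagram} (t : Tableau n μ) (m : ℕ) (v : V n) :
    (up n ^ m) (colAntisymm t v) = colAntisymm t ((up n ^ m) v) := by
  simp only [colAntisymm, LinearMap.sum_apply, map_sum, LinearMap.smul_apply, map_smul,
    pow_up_boolRep]

theorem colAntisymm_mem_level {n i : ℕ} {μ : YoungDiagram} (t : Tableau n μ) {v : V n}
    (hv : v ∈ level n i) : colAntisymm t v ∈ level n i := by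
  rw [colAntisymm, LinearMap.sum_apply]
  exact Submodule.sum_mem _ fun σ _ => Submodule.smul_mem _ _ (boolRep_mem_level σ hv)

/-- The column antisymmetrizer kills every set containing two elements of the same column. -/
theorem colAntisymm_single_eq_zero {n : ℕ} {μ : YoungDiagram} (t : Tableau n μ)
    {Y : Finset (Fin n)} {a b : Fin n} (ha : a ∈ Y) (hb : b ∈ Y) (hab : a ≠ b)
    (hcol : (t a).1.2 = (t b).1.2) : colAntisymm t (Finsupp.single Y 1) = 0 := by
  classical
  have hY : Y.map (Equiv.swap a b).toEmbedding = Y := by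
    ext x
    rw [Finset.mem_map_equiv, Equiv.symm_swap]
    rcases eq_or_ne x a with rfl | hxa
    · simp [ha, hb]
    · rcases eq_or_ne x b with rfl | hxb
      · simp [ha, hb]
      · rw [Equiv.swap_apply_of_ne_of_ne hxa hxb]
  have hcs : ∀ x, (t (Equiv.swap a b x)).1.2 = (t x).1.2 := by
    intro x
    rcases eq_or_ne x a with rfl | hxa
    · rw [Equiv.swap_apply_left, hcol]
    · rcases eq_or_ne x b with rfl | hxb
      · rw [Equiv.swap_apply_right, hcol]
      · rw [Equiv.swap_apply_of_ne_of_ne hxa hxb]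
  rw [colAntisymm, LinearMap.sum_apply]
  -- The terms of `σ` and `σ * swap a b` have opposite signs and the same image of `Y`, so they
  -- cancel.
  refine Finset.sum_involution (fun σ _ => σ * Equiv.swap a b) ?_ ?_ ?_ ?_
  · intro σ _
    rw [LinearMap.smul_apply, LinearMap.smul_apply, map_mul (boolRep n), Module.End.mul_apply,
      boolRep_single (Equiv.swap a b), hY, Equiv.Perm.sign_mul, Equiv.Perm.sign_swap hab]
    simp
  · intro σ _ _ h
    exact hab (Equiv.swap_eq_one_iff.mp (mul_eq_left.mp h))
  · intro σ hσ
    simp only [Finset.mem_filter, Finset.mem_univ, true_and] at hσ ⊢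
    intro x
    rw [Equiv.Perm.mul_apply, hσ, hcs]
  · intro σ _
    rw [mul_assoc, Equiv.swap_mul_self, mul_one]

theorem card_secondRow_tabloid {n k : ℕ} (h : 2 * k ≤ n) (t : Tableau n (twoRow n k h)) :
    (secondRow (tabloid t)).card = k := by
  have h1 : (secondRow (tabloid t)).card = (Finset.range k).card := by
    refine Finset.card_bij (fun x _ => (t x).1.2) ?_ ?_ ?_
    · intro x hx
      rw [mem_secondRow, tabloid] at hx
      have h2 := (mem_twoRow h).mp (t x).2
      rw [Finset.mem_range]
      omega
    · intro x hx y hy hxy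
      rw [mem_secondRow] at hx hy
      exact t.injective (Subtype.ext (Prod.ext (hx.trans hy.symm) hxy))
    · intro b hb
      refine ⟨t.symm ⟨(1, b), (mem_twoRow h).mpr (Or.inr ⟨rfl, Finset.mem_range.mp hb⟩)⟩, ?_, ?_⟩
      · rw [mem_secondRow, tabloid, Equiv.apply_symm_apply]
      · rw [Equiv.apply_symm_apply]
  rw [h1, Finset.card_range]

theorem secondRowMap_polytabloid_mem_W {n k : ℕ} (h : 2 * k ≤ n) (t : Tableau n (twoRow n k h)) :
    secondRowMap n (polytabloid t) ∈ W n k k := by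
  have hX : Finsupp.single (secondRow (tabloid t)) (1 : ℂ) ∈ level n k := by
    have h1 := single_mem_level (secondRow (tabloid t)) 1
    rwa [card_secondRow_tabloid] at h1
  rw [mem_W_self_iff h, secondRowMap_polytabloid, colAntisymm_pow_up]
  refine ⟨colAntisymm_mem_level t hX, ?_⟩
  -- The rank reached is `n - k + 1`, one more than the number of columns, so every set there has
  -- two elements in one column.
  have hle : level n (k + (n - 2 * k + 1)) ≤ LinearMap.ker (colAntisymm t) := by
    refine Submodule.span_le.mpr ?_
    rintro _ ⟨Y, hY, rfl⟩
    have hlt : (Finset.range (n - k)).card < Y.card := by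
      rw [Finset.card_range]
      omega
    obtain ⟨a, ha, b, hb, hab, hcol⟩ :=
      Finset.exists_ne_map_eq_of_card_lt_of_maps_to (f := fun x => (t x).1.2) hlt (by
        intro x _
        have h2 := (mem_twoRow h).mp (t x).2
        simp only [Finset.coe_range, Set.mem_Iio]
        omega)
    exact colAntisymm_single_eq_zero t ha hb hab hcol
  exact hle (pow_up_mem_level hX _)

/-- The coefficient at the second row of `t` is `1`: a column-preserving permutation that stabilizes
the second row preserves every box, so only the identity contributes. -/
theorem secondRowMap_polytabloid_ne_zero {n k : ℕ} (h : 2 * k ≤ n)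
    (t : Tableau n (twoRow n k h)) : secondRowMap n (polytabloid t) ≠ 0 := by
  classical
  have hrow : ∀ x, x ∈ secondRow (tabloid t) ↔ (t x).1.1 = 1 :=
    fun _ => mem_secondRow
  suffices h1 : secondRowMap n (polytabloid t) (secondRow (tabloid t)) = 1 by
    intro h0
    rw [h0] at h1
    exact zero_ne_one h1
  rw [secondRowMap_polytabloid, colAntisymm, LinearMap.sum_apply, Finsupp.finsetSum_apply,
    Finset.sum_eq_single 1]
  · simp
  · intro σ hσ hσ1
    simp only [Finset.mem_filter, Finset.mem_univ, true_and] at hσ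
    rw [LinearMap.smul_apply, boolRep_single, Finsupp.smul_apply, Finsupp.single_eq_of_ne, smul_zero]
    intro heq
    refine hσ1 (Equiv.ext fun x => t.injective (Subtype.ext (Prod.ext ?_ (hσ x))))
    have h2 : σ x ∈ secondRow (tabloid t) ↔ x ∈ secondRow (tabloid t) := by
      conv_lhs => rw [heq]
      simp
    rw [hrow, hrow] at h2
    have h3 := (mem_twoRow h).mp (t (σ x)).2
    have h4 := (mem_twoRow h).mp (t x).2
    rw [Equiv.Perm.one_apply]
    omega
  · intro h1
    simp at h1

theorem map_secondRowMap_specht_le {n k : ℕ} (h : 2 * k ≤ n) :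
    (spechtTwoRow n k h).toSubmodule.map (secondRowMap n) ≤ W n k k := by
  refine (Submodule.map_span_le _ _ _).mpr ?_
  rintro _ ⟨t, rfl⟩
  exact secondRowMap_polytabloid_mem_W h t

theorem polytabloid_mem_spechtTwoRow {n k : ℕ} (h : 2 * k ≤ n) (t : Tableau n (twoRow n k h)) :
    polytabloid t ∈ (spechtTwoRow n k h).toSubmodule :=
  Submodule.subset_span ⟨t, rfl⟩

/-! ### The isomorphism of `V^{(n-k,k)}` with `W(n,k,i)` -/

/-- A left inverse of `secondRowMap` on the span of the tabloids with two rows. -/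
def rowIndicator (n : ℕ) : V n →ₗ[ℂ] ((Fin n → ℕ) →₀ ℂ) :=
  Finsupp.lmapDomain ℂ ℂ fun X x => if x ∈ X then 1 else 0

theorem rowIndicator_secondRowMap {n k : ℕ} (h : 2 * k ≤ n) {v : (Fin n → ℕ) →₀ ℂ}
    (hv : v ∈ (spechtTwoRow n k h).toSubmodule) : rowIndicator n (secondRowMap n v) = v := by
  have hle : (spechtTwoRow n k h).toSubmodule ≤
      LinearMap.eqLocus (rowIndicator n ∘ₗ secondRowMap n) LinearMap.id := by
    refine Submodule.span_le.mpr ?_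
    rintro _ ⟨t, rfl⟩
    change polytabloid t ∈ LinearMap.eqLocus _ _
    rw [polytabloid]
    refine Submodule.sum_mem _ fun σ _ => Submodule.smul_mem _ _ ?_
    simp only [rowRep, MonoidHom.coe_mk, OneHom.coe_mk, Finsupp.lmapDomain_apply,
      Finsupp.mapDomain_single]
    rw [LinearMap.mem_eqLocus, LinearMap.comp_apply, LinearMap.id_apply, secondRowMap,
      rowIndicator, Finsupp.lmapDomain_apply, Finsupp.lmapDomain_apply, Finsupp.mapDomain_single,
      Finsupp.mapDomain_single]
    congr 1
    funext x
    have h2 := (mem_twoRow h).mp (t (σ⁻¹ x)).2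
    simp only [mem_secondRow, tabloid, Function.comp_apply]
    split_ifs <;> omega
  exact hle hv

/-- The equivariant map from a two-row Specht module to `V(B(n)_i)`. -/
def spechtToLevel (n k i : ℕ) : ((Fin n → ℕ) →₀ ℂ) →ₗ[ℂ] V n :=
  (up n ^ (i - k)) ∘ₗ secondRowMap n

theorem spechtToLevel_rowRep {n k i : ℕ} (g : Equiv.Perm (Fin n)) (v : (Fin n → ℕ) →₀ ℂ) :
    spechtToLevel n k i (rowRep n g v) = boolRep n g (spechtToLevel n k i v) := by
  rw [spechtToLevel, LinearMap.comp_apply, secondRowMap_rowRep, pow_up_boolRep]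
  rfl

/-- The power of `up n` is injective on `W n k k`, and a two-row tabloid is recovered from its
second row. -/
theorem eq_zero_of_spechtToLevel_eq_zero {n k i : ℕ} (hki : k ≤ i) (hin : i + k ≤ n)
    {v : (Fin n → ℕ) →₀ ℂ} (hv : v ∈ (spechtTwoRow n k (two_mul_le hki hin)).toSubmodule)
    (h0 : spechtToLevel n k i v = 0) : v = 0 := by
  have h : 2 * k ≤ n := two_mul_le hki hin
  have h1 := Submodule.disjoint_def.mp (disjoint_W_ker_pow_up hki hin) _
    (map_secondRowMap_specht_le h ⟨v, hv, rfl⟩) h0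
  rw [← rowIndicator_secondRowMap h hv, h1, map_zero]

/-- The image is a nonzero invariant subspace of `W n k i`. Irreducibility of the Specht module is
not used; it follows from the isomorphism. -/
theorem map_spechtToLevel {n k i : ℕ} (hki : k ≤ i) (hin : i + k ≤ n) :
    (spechtTwoRow n k (two_mul_le hki hin)).toSubmodule.map (spechtToLevel n k i) = W n k i := by
  have h : 2 * k ≤ n := two_mul_le hki hin
  refine eq_W_of_invariant (by omega) ?_ ?_ ?_
  · rintro g _ ⟨v, hv, rfl⟩
    exact ⟨_, (spechtTwoRow n k h).apply_mem_toSubmodule g hv, spechtToLevel_rowRep g v⟩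
  · rw [spechtToLevel, Submodule.map_comp, W_eq_map hki hin]
    exact Submodule.map_mono (map_secondRowMap_specht_le h)
  · obtain ⟨t⟩ := nonempty_tableau h
    refine (Submodule.ne_bot_iff _).mpr
      ⟨_, ⟨polytabloid t, polytabloid_mem_spechtTwoRow h t, rfl⟩, fun h0 => ?_⟩
    have h1 := eq_zero_of_spechtToLevel_eq_zero hki hin (polytabloid_mem_spechtTwoRow h t) h0
    exact secondRowMap_polytabloid_ne_zero h t (by rw [h1, map_zero])

/-- The isomorphism of the Specht module `V^{(n-k,k)}` with `W(n,k,i)`. -/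
def spechtEquivW {n k i : ℕ} (hki : k ≤ i) (hin : i + k ≤ n) :
    (spechtTwoRow n k (two_mul_le hki hin)).toSubmodule ≃ₗ[ℂ] W n k i :=
  LinearEquiv.ofBijective
    ((spechtToLevel n k i).restrict fun v hv =>
      (map_spechtToLevel hki hin).le ⟨v, hv, rfl⟩) <| by
    refine ⟨(injective_iff_map_eq_zero _).mpr fun v hv => ?_, fun w => ?_⟩
    · exact Subtype.ext (eq_zero_of_spechtToLevel_eq_zero hki hin v.2 (congrArg Subtype.val hv))
    · obtain ⟨v, hv, hvw⟩ := (map_spechtToLevel hki hin).ge w.2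
      exact ⟨⟨v, hv⟩, Subtype.ext hvw⟩

theorem coe_spechtEquivW {n k i : ℕ} (hki : k ≤ i) (hin : i + k ≤ n)
    (v : (spechtTwoRow n k (two_mul_le hki hin)).toSubmodule) :
    (spechtEquivW hki hin v : V n) = spechtToLevel n k i v := rfl

theorem nonempty_equiv_specht {n k i : ℕ} (hki : k ≤ i) (hin : i + k ≤ n)
    (hW : ∀ g : Equiv.Perm (Fin n), W n k i ≤ (W n k i).comap (boolRep n g)) :
    Nonempty (((boolRep n).subrepresentation (W n k i) hW).Equiv
      (spechtTwoRow n k (two_mul_le hki hin)).toRepresentation) :=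
  ⟨(Representation.Equiv.mk (ρ := (spechtTwoRow n k (two_mul_le hki hin)).toRepresentation)
    (σ := (boolRep n).subrepresentation (W n k i) hW) (spechtEquivW hki hin) fun g =>
    LinearMap.ext fun v => Subtype.ext (spechtToLevel_rowRep (k := k) (i := i) g v.1)).symm⟩

/-- Summand-wise isomorphisms are followed by the summation map, injective by independence and with
range `level n i`; equivariance is checked on each summand. -/
theorem nonempty_levelSub_equiv_directSum (n i : ℕ) :
    Nonempty ((levelSub n i).toRepresentation.Equiv
      (Representation.directSum fun k : {k : ℕ // k ≤ i ∧ i + k ≤ n} =>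
        (spechtTwoRow n k (two_mul_le k.2.1 k.2.2)).toRepresentation)) := by
  classical
  let e : (⨁ k : {k : ℕ // k ≤ i ∧ i + k ≤ n},
      (spechtTwoRow n k (two_mul_le k.2.1 k.2.2)).toSubmodule) ≃ₗ[ℂ]
        ⨁ k : {k : ℕ // k ≤ i ∧ i + k ≤ n}, W n k i :=
    DFinsupp.mapRange.linearEquiv fun k => spechtEquivW k.2.1 k.2.2
  let f : (⨁ k : {k : ℕ // k ≤ i ∧ i + k ≤ n}, W n k i) →ₗ[ℂ] V n :=
    DirectSum.coeLinearMap fun k : {k : ℕ // k ≤ i ∧ i + k ≤ n} => W n k i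
  have hf : Function.Injective f := (iSupIndep_W n i).dfinsupp_lsum_injective
  have hrange : LinearMap.range f = level n i := by
    rw [← iSup_W, Submodule.iSup_eq_range_dfinsupp_lsum]
    rfl
  let F := e.trans ((LinearEquiv.ofInjective f hf).trans (LinearEquiv.ofEq _ _ hrange))
  let D := Representation.directSum fun k : {k : ℕ // k ≤ i ∧ i + k ≤ n} =>
    (spechtTwoRow n k (two_mul_le k.2.1 k.2.2)).toRepresentation
  have hfe : ∀ (k : {k : ℕ // k ≤ i ∧ i + k ≤ n})
      (w : (spechtTwoRow n k (two_mul_le k.2.1 k.2.2)).toSubmodule),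
      f (e (DirectSum.lof ℂ _ _ k w)) = spechtToLevel n k i w := by
    intro k w
    have h2 : e (DirectSum.lof ℂ _ _ k w) =
        DirectSum.lof ℂ _ (fun k : {k : ℕ // k ≤ i ∧ i + k ≤ n} => W n k i) k
          (spechtEquivW k.2.1 k.2.2 w) := DFinsupp.mapRange_single (hf := fun _ => map_zero _)
    rw [h2]
    exact (DirectSum.coeLinearMap_lof _ _ _).trans (coe_spechtEquivW k.2.1 k.2.2 w)
  have key : ∀ g x, f (e (D g x)) = boolRep n g (f (e x)) := by
    intro g
    suffices h : f ∘ₗ e.toLinearMap ∘ₗ D g = boolRep n g ∘ₗ f ∘ₗ e.toLinearMap from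
      LinearMap.congr_fun h
    refine DirectSum.linearMap_ext _ fun k => LinearMap.ext fun v => ?_
    have h1 : D g (DirectSum.lof ℂ _ _ k v) = DirectSum.lof ℂ _ _ k
        ((spechtTwoRow n k (two_mul_le k.2.1 k.2.2)).toRepresentation g v) :=
      DirectSum.lmap_lof _ _ _
    change f (e (D g (DirectSum.lof ℂ _ _ k v))) = boolRep n g (f (e (DirectSum.lof ℂ _ _ k v)))
    rw [h1, hfe, hfe]
    exact spechtToLevel_rowRep g v.1
  exact ⟨(Representation.Equiv.mk (ρ := D) (σ := (levelSub n i).toRepresentation) F fun g =>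
    LinearMap.ext fun x => Subtype.ext (key g x)).symm⟩

end BooleanSJB

end

theorem mainTheorem11 (n : ℕ) :
    -- the inductive construction yields a symmetric Jordan basis of `V(B(n))`
    BooleanSJB.IsSymmJordanBasis n (BooleanSJB.sjb n) ∧
    -- each `W(n,k,i)` is an irreducible `S_n`-submodule, isomorphic to `V^{(n-k,k)}`
    (∀ (k i : ℕ) (hki : k ≤ i) (hin : i + k ≤ n),
      ∃ hW : ∀ g : Equiv.Perm (Fin n),
          BooleanSJB.W n k i ≤ (BooleanSJB.W n k i).comap (BooleanSJB.boolRep n g),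
        Representation.IsIrreducible (k := ℂ) (V := BooleanSJB.W n k i)
          ((BooleanSJB.boolRep n).subrepresentation (BooleanSJB.W n k i) hW) ∧
        Nonempty (((BooleanSJB.boolRep n).subrepresentation (BooleanSJB.W n k i) hW).Equiv
          (BooleanSJB.spechtTwoRow n k (by omega)).toRepresentation)) ∧
    (∀ i : ℕ, i ≤ n →
      -- `V(B(n)_i)` is the internal direct sum of the `W(n,k,i)` with `k ≤ i ≤ n - k`
      iSupIndep (fun k : {k : ℕ // k ≤ i ∧ i + k ≤ n} => BooleanSJB.W n k i) ∧
      (⨆ k : {k : ℕ // k ≤ i ∧ i + k ≤ n}, BooleanSJB.W n k i) = BooleanSJB.level n i ∧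
      -- hence `V(B(n)_i)` is isomorphic to the direct sum of the `V^{(n-k,k)}` ...
      Nonempty ((BooleanSJB.levelSub n i).toRepresentation.Equiv
        (Representation.directSum fun k : {k : ℕ // k ≤ i ∧ i + k ≤ n} =>
          (BooleanSJB.spechtTwoRow n k (by have := k.2; omega)).toRepresentation)) ∧
      -- ... and it is multiplicity free
      BooleanSJB.IsMultiplicityFree (BooleanSJB.levelSub n i).toRepresentation) := by
  refine ⟨BooleanSJB.isSymmJordanBasis_sjb n, fun k i hki hin => ?_, fun i hi =>
    ⟨BooleanSJB.iSupIndep_W n i, BooleanSJB.iSup_W n i,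
      BooleanSJB.nonempty_levelSub_equiv_directSum n i, BooleanSJB.isMultiplicityFree_level hi⟩⟩
  have hW : ∀ g : Equiv.Perm (Fin n),
      BooleanSJB.W n k i ≤ (BooleanSJB.W n k i).comap (BooleanSJB.boolRep n g) :=
    fun g _ hv => BooleanSJB.boolRep_mem_W hki hin g hv
  exact ⟨hW, BooleanSJB.isIrreducible_W hki hin hW, BooleanSJB.nonempty_equiv_specht hki hin hW⟩
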